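/- A polytope is the convex hull of a finite set of points. For a polytope $P$ and $k\ge 0$ let $f_k(P)$ be the number of its $k$-dimensional faces, a nonempty face being the set of maximizers over $P$ of a linear function. For polytopes $P_1,\ldots,P_n$, every nonempty face $F$ of the Minkowski sum $P=P_1+\cdots+P_n$ can be written in exactly one way as $F=F_1+\cdots+F_n$ with $F_i$ a face of $P_i$; this decomposition is called exact if $\dim F=\dim F_1+\cdots+\dim F_n$. The polytopes are relatively in general position if the decomposition of every facet of $P$ is exact. **Theorem.** Let $n\ge 1$, let $P_1,\ldots,P_n$ be $3$-dimensional polytopes in $\mathbb{R}^3$ that are relatively in general position, and let $P=P_1+\cdots+P_n$ be their Minkowski sum. Then $$2f_2(P)-f_1(P)=\sum_{i=1}^n\bigl(2f_2(P_i)-f_1(P_i)\bigr),$$ $$f_2(P)-f_0(P)+2=\sum_{i=1}^n\bigl(f_2(P_i)-f_0(P_i)+2\bigr),$$ $$f_1(P)-2f_0(P)+4=\sum_{i=1}^n\bigl(f_1(P_i)-2f_0(P_i)+4\bigr).$$ -/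

import Mathlib

open scoped Pointwise

namespace PolytopeSum

variable {E : Type*} [NormedAddCommGroup E] [NormedSpace ℝ E]

/-- A polytope: the convex hull of a finite set of points. -/
def IsPolytope (P : Set E) : Prop :=
  ∃ s : Set E, s.Finite ∧ P = convexHull ℝ s

/-- The dimension of the affine hull of a nonempty set. -/
noncomputable def dim (F : Set E) : ℕ :=
  Module.finrank ℝ (vectorSpan ℝ F)

/-- `F` is a nonempty face of `P`: the set of maximizers over `P` of a linear function
(the zero function gives `P` itself). -/
def IsFace (P F : Set E) : Prop :=
  F.Nonempty ∧ IsExposed ℝ P F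

/-- A facet: a nonempty face of codimension one. -/
def IsFacet (P F : Set E) : Prop :=
  IsFace P F ∧ dim F + 1 = dim P

/-- `f_k(P)`, the number of `k`-dimensional faces of `P`. -/
noncomputable def numFaces (k : ℕ) (P : Set E) : ℕ :=
  {F : Set E | IsFace P F ∧ dim F = k}.ncard

/-- `G` is a decomposition of `F`, as a sum of faces `G i` of the summands `P i`. -/
def IsDecomposition {n : ℕ} (P : Fin n → Set E) (F : Set E) (G : Fin n → Set E) : Prop :=
  (∀ i, IsFace (P i) (G i)) ∧ F = ∑ i, G i

/-- The polytopes `P i` are relatively in general position: the decomposition of every facet of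
the Minkowski sum is exact, i.e. the dimensions of its summands add up to that of the facet.
(Every face of a sum of polytopes has exactly one decomposition.) -/
def RelativelyInGeneralPosition {n : ℕ} (P : Fin n → Set E) : Prop :=
  ∀ F : Set E, IsFacet (∑ i, P i) F →
    ∀ G : Fin n → Set E, IsDecomposition P F G → dim F = ∑ i, dim (G i)

end PolytopeSum

/-! Euler's formula turns each of the three expressions into `2 f₂ - f₁`, so only the additivity of
that one needs geometry. Every edge lies in two facets and a polygon has as many edges as vertices,
so summing `4 - f₀(F)` over the facets of a 3-polytope gives `2 (2 f₂ - f₁)`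
(`sum_four_sub_numFaces_zero`). An exact facet of the sum is either a translate of a polygonal facet
of one summand or a parallelogram, of weight `4 - 4 = 0` (`four_sub_numFaces_zero_sum`). Matching
outer normals puts the facets of `P i` in bijection with the facets of the sum whose `i`-th
component is two-dimensional, so the weights add up (`two_mul_numFaces_two_sub_numFaces_one_sum`).

Euler's formula is proved by a sweep with a functional `l` injective on the vertices. Count pairs of
a facet and a vertex of it that is neither highest nor lowest there. A facet has `f₀(F) - 2` such
vertices; a vertex of `P` other than the top and the bottom occurs in exactly two pairs
(`ncard_facets_middleVertices`), the top and bottom in none. Hence `2 f₁ - 2 f₂ = 2 (f₀ - 2)`. -/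

namespace PolytopeSum

variable {E : Type*} [NormedAddCommGroup E] [NormedSpace ℝ E]

/-! ### Exposed faces, vertices and dimension of polytopes -/

section Basic

variable {P F G : Set E}

lemma isFace_iff : IsFace P F ↔ F.Nonempty ∧ ∃ u : StrongDual ℝ E, F = u.toExposed P :=
  ⟨fun h => ⟨h.1, h.2 h.1⟩, fun h => ⟨h.1, fun _ => h.2⟩⟩

lemma isFace_toExposed {u : StrongDual ℝ E} (h : (u.toExposed P).Nonempty) :
    IsFace P (u.toExposed P) :=
  isFace_iff.2 ⟨h, u, rfl⟩

lemma mem_toExposed {u : StrongDual ℝ E} {x : E} :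
    x ∈ u.toExposed P ↔ x ∈ P ∧ ∀ y ∈ P, u y ≤ u x := Iff.rfl

lemma apply_eq_of_mem_toExposed {u : StrongDual ℝ E} {x y : E} (hx : x ∈ u.toExposed P)
    (hy : y ∈ u.toExposed P) : u x = u y :=
  le_antisymm (hy.2 x hx.1) (hx.2 y hy.1)

lemma mem_toExposed_of_apply_eq {u : StrongDual ℝ E} {x y : E} (hx : x ∈ u.toExposed P)
    (hy : y ∈ P) (h : u y = u x) : y ∈ u.toExposed P :=
  ⟨hy, fun z hz => (hx.2 z hz).trans h.ge⟩

lemma apply_lt_of_notMem_toExposed {u : StrongDual ℝ E} {x y : E} (hx : x ∈ u.toExposed P)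
    (hy : y ∈ P) (h : y ∉ u.toExposed P) : u y < u x :=
  lt_of_le_of_ne (hx.2 y hy) fun e => h (mem_toExposed_of_apply_eq hx hy e)

lemma IsFace.subset (h : IsFace P F) : F ⊆ P := h.2.subset

lemma IsFace.mono (h : IsFace P G) (hF : F ⊆ P) (hG : G ⊆ F) : IsFace F G :=
  ⟨h.1, h.2.mono hF hG⟩

lemma IsFace.extremePoints_eq (h : IsFace P F) :
    F.extremePoints ℝ = F ∩ P.extremePoints ℝ :=
  h.2.isExtreme.extremePoints_eq

lemma IsPolytope.isCompact (h : IsPolytope P) : IsCompact P := by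
  obtain ⟨s, hs, rfl⟩ := h
  exact hs.isCompact_convexHull ℝ

lemma IsPolytope.convex (h : IsPolytope P) : Convex ℝ P := by
  obtain ⟨s, hs, rfl⟩ := h
  exact convex_convexHull ℝ s

lemma IsPolytope.finite_extremePoints (h : IsPolytope P) : (P.extremePoints ℝ).Finite := by
  obtain ⟨s, hs, rfl⟩ := h
  exact hs.subset extremePoints_convexHull_subset

lemma IsPolytope.convexHull_extremePoints (h : IsPolytope P) :
    convexHull ℝ (P.extremePoints ℝ) = P := by
  have := closure_convexHull_extremePoints h.isCompact h.convex
  rwa [(h.finite_extremePoints.isCompact_convexHull ℝ).isClosed.closure_eq] at this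

lemma IsPolytope.subset_of_extremePoints_subset (h : IsPolytope P) {C : Set E}
    (hC : Convex ℝ C) (hPC : P.extremePoints ℝ ⊆ C) : P ⊆ C := by
  rw [← h.convexHull_extremePoints]
  exact convexHull_min hPC hC

lemma IsPolytope.apply_le (h : IsPolytope P) {u : StrongDual ℝ E} {c : ℝ}
    (hu : ∀ w ∈ P.extremePoints ℝ, u w ≤ c) {x : E} (hx : x ∈ P) : u x ≤ c :=
  h.subset_of_extremePoints_subset (convex_halfSpace_le u.toLinearMap.isLinear c) hu hx

lemma IsPolytope.mem_toExposed (h : IsPolytope P) {u : StrongDual ℝ E} {x : E} (hx : x ∈ P)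
    (hu : ∀ w ∈ P.extremePoints ℝ, u w ≤ u x) : x ∈ u.toExposed P :=
  ⟨hx, fun _ hy => h.apply_le hu hy⟩

lemma IsPolytope.nonempty_toExposed (h : IsPolytope P) (hne : P.Nonempty)
    (u : StrongDual ℝ E) : (u.toExposed P).Nonempty := by
  obtain ⟨x, hx, hmax⟩ := h.isCompact.exists_isMaxOn hne u.continuous.continuousOn
  exact ⟨x, hx, fun y hy => hmax hy⟩

lemma IsFace.isPolytope (hP : IsPolytope P) (h : IsFace P F) : IsPolytope F := by
  have hc : IsCompact F := h.2.isCompact hP.isCompact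
  have hv : Convex ℝ F := h.2.convex hP.convex
  have hfin : (F.extremePoints ℝ).Finite := by
    rw [h.extremePoints_eq]
    exact hP.finite_extremePoints.subset Set.inter_subset_right
  refine ⟨F.extremePoints ℝ, hfin, ?_⟩
  have := closure_convexHull_extremePoints hc hv
  rw [(hfin.isCompact_convexHull ℝ).isClosed.closure_eq] at this
  exact this.symm

lemma IsPolytope.nonempty_extremePoints (h : IsPolytope P) (hne : P.Nonempty) :
    (P.extremePoints ℝ).Nonempty :=
  h.isCompact.extremePoints_nonempty hne

/-- A face is the hull of its vertices, which are among the finitely many vertices of `P`. -/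
lemma IsPolytope.finite_faces (hP : IsPolytope P) : {F : Set E | IsFace P F}.Finite := by
  refine Set.Finite.of_finite_image (f := fun F => F.extremePoints ℝ)
    (hP.finite_extremePoints.finite_subsets.subset ?_) ?_
  · rintro _ ⟨F, hF, rfl⟩
    exact (IsFace.extremePoints_eq hF).trans_subset Set.inter_subset_right
  · intro F hF G hG h
    rw [← (IsFace.isPolytope hP hF).convexHull_extremePoints,
      ← (IsFace.isPolytope hP hG).convexHull_extremePoints]
    exact congrArg _ h

/-- If `f` exposes `F` in `P` and `g` exposes `G` in `F`, then a large multiple of `f` plus `g`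
exposes `G` in `P`: only finitely many vertices outside `F` have to be beaten. -/
lemma IsFace.trans (hP : IsPolytope P) (hF : IsFace P F) (hG : IsFace F G) : IsFace P G := by
  have hGne := hG.1
  obtain ⟨-, f, hf⟩ := isFace_iff.1 hF
  obtain ⟨⟨p, hp⟩, g, hg⟩ := isFace_iff.1 hG
  have hpF : p ∈ f.toExposed P := hf ▸ hG.subset hp
  -- The ratio is the multiple of `f` at which `w` would tie with `p`; `|c| + 1` strictly exceeds
  -- all of them.
  obtain ⟨c, hc⟩ := (hP.finite_extremePoints.image
    (fun w => (g w - g p) / (f p - f w))).bddAbove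
  have key : ∀ w ∈ P.extremePoints ℝ, w ∉ F →
      ((|c| + 1) • f + g) w < ((|c| + 1) • f + g) p := by
    intro w hw hwF
    have hlt : f w < f p := apply_lt_of_notMem_toExposed hpF hw.1 (hf ▸ hwF)
    have h1 : (g w - g p) / (f p - f w) ≤ c := hc ⟨w, hw, rfl⟩
    have h2 : (g w - g p) / (f p - f w) < |c| + 1 := by linarith [le_abs_self c]
    rw [div_lt_iff₀ (by linarith)] at h2
    simp only [add_apply, smul_apply, smul_eq_mul]
    linarith
  have key' : ∀ w ∈ F, ((|c| + 1) • f + g) w - ((|c| + 1) • f + g) p = g w - g p := by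
    intro w hw
    have : f w = f p := apply_eq_of_mem_toExposed (P := P) (hf ▸ hw) hpF
    simp [this]
  rw [hg] at hp
  have hpu : p ∈ ((|c| + 1) • f + g).toExposed P := by
    refine hP.mem_toExposed hpF.1 fun w hw => ?_
    by_cases hwF : w ∈ F
    · linarith [key' w hwF, hp.2 w hwF]
    · exact (key w hw hwF).le
  refine isFace_iff.2 ⟨hGne, (|c| + 1) • f + g, Set.Subset.antisymm ?_ ?_⟩
  · intro x hx
    have hxF := hG.subset hx
    refine mem_toExposed_of_apply_eq hpu (hF.subset hxF) ?_
    have : g x = g p := apply_eq_of_mem_toExposed (hg ▸ hx) hp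
    linarith [key' x hxF]
  · have hface := isFace_toExposed ⟨p, hpu⟩
    refine (IsFace.isPolytope hP hface).subset_of_extremePoints_subset
      (hG.2.convex (hF.2.convex hP.convex)) ?_
    rw [hface.extremePoints_eq]
    rintro w ⟨hwu, hw⟩
    have he := apply_eq_of_mem_toExposed hwu hpu
    have hwF : w ∈ F := by
      by_contra hwF
      exact (key w hw hwF).ne he
    rw [hg]
    exact mem_toExposed_of_apply_eq hp hwF (by linarith [key' w hwF])

/-- The faces of a face `F` of a polytope `P` are the faces of `P` contained in `F`. -/
lemma IsFace.isFace_iff (hP : IsPolytope P) (hF : IsFace P F) :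
    IsFace F G ↔ IsFace P G ∧ G ⊆ F :=
  ⟨fun h => ⟨hF.trans hP h, h.subset⟩, fun h => h.1.mono hF.subset h.2⟩

/-- Hahn–Banach separates `v` from the hull of the other vertices, which is closed because they are
finite in number. -/
lemma IsPolytope.isFace_singleton (hP : IsPolytope P) {v : E} (hv : v ∈ P.extremePoints ℝ) :
    IsFace P {v} := by
  have hfin : (P.extremePoints ℝ \ {v}).Finite := hP.finite_extremePoints.subset Set.sdiff_subset
  have hnot : v ∉ convexHull ℝ (P.extremePoints ℝ \ {v}) := by
    have h := (hP.convex.mem_extremePoints_iff_mem_sdiff_convexHull_sdiff.1 hv).2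
    exact fun h' => h (convexHull_mono (Set.sdiff_subset_sdiff_left extremePoints_subset) h')
  obtain ⟨f, a, h1, h2⟩ := geometric_hahn_banach_closed_point (convex_convexHull ℝ _)
    (hfin.isCompact_convexHull ℝ).isClosed hnot
  have hlt : ∀ w ∈ P.extremePoints ℝ, w ≠ v → f w < f v := fun w hw hne =>
    (h1 w (subset_convexHull ℝ _ ⟨hw, hne⟩)).trans h2
  have hvf : v ∈ f.toExposed P := by
    refine hP.mem_toExposed hv.1 fun w hw => ?_
    rcases eq_or_ne w v with rfl | hne
    exacts [le_rfl, (hlt w hw hne).le]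
  refine PolytopeSum.isFace_iff.2 ⟨Set.singleton_nonempty v, f,
    Set.Subset.antisymm (Set.singleton_subset_iff.2 hvf) ?_⟩
  have hface := isFace_toExposed ⟨v, hvf⟩
  refine (hface.isPolytope hP).subset_of_extremePoints_subset (convex_singleton v) ?_
  rw [hface.extremePoints_eq]
  rintro w ⟨hwf, hw⟩
  by_contra hne
  exact (hlt w hw hne).ne (apply_eq_of_mem_toExposed hwf hvf)

lemma isFace_singleton_iff (hP : IsPolytope P) {v : E} :
    IsFace P {v} ↔ v ∈ P.extremePoints ℝ :=
  ⟨fun h => isExtreme_singleton.1 h.2.isExtreme, hP.isFace_singleton⟩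

lemma vectorSpan_le_iff {S : Set E} {T : Submodule ℝ E} {p : E} (hp : p ∈ S) :
    vectorSpan ℝ S ≤ T ↔ ∀ x ∈ S, x - p ∈ T := by
  rw [vectorSpan_eq_span_vsub_set_right ℝ hp, Submodule.span_le]
  constructor
  · intro h x hx
    exact h ⟨x, hx, rfl⟩
  · rintro h _ ⟨x, hx, rfl⟩
    exact h x hx

lemma apply_eq_zero_of_mem_vectorSpan {S : Set E} {u : StrongDual ℝ E} {p : E} (hp : p ∈ S)
    (h : ∀ x ∈ S, u x = u p) {y : E} (hy : y ∈ vectorSpan ℝ S) : u y = 0 := by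
  have : vectorSpan ℝ S ≤ LinearMap.ker u.toLinearMap :=
    (vectorSpan_le_iff hp).2 fun x hx => by simp [h x hx]
  exact this hy

lemma sub_mem_vectorSpan {S : Set E} {x y : E} (hx : x ∈ S) (hy : y ∈ S) :
    x - y ∈ vectorSpan ℝ S :=
  vsub_mem_vectorSpan ℝ hx hy

lemma eq_of_mem_toExposed_of_vectorSpan {u : StrongDual ℝ E} (hne : (u.toExposed P).Nonempty)
    (h : ∀ y ∈ vectorSpan ℝ P, u y = 0) : u.toExposed P = P := by
  obtain ⟨p, hp⟩ := hne
  refine Set.Subset.antisymm (fun x hx => hx.1) fun x hx => mem_toExposed_of_apply_eq hp hx ?_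
  have := h _ (sub_mem_vectorSpan hx hp.1)
  rw [map_sub] at this
  linarith

lemma toExposed_eq_self_iff {u : StrongDual ℝ E} (hne : (u.toExposed P).Nonempty) :
    u.toExposed P = P ↔ ∀ y ∈ vectorSpan ℝ P, u y = 0 := by
  refine ⟨fun h y hy => ?_, eq_of_mem_toExposed_of_vectorSpan hne⟩
  obtain ⟨p, hp⟩ := hne
  exact apply_eq_zero_of_mem_vectorSpan hp.1
    (fun x hx => apply_eq_of_mem_toExposed (P := P) (h.symm ▸ hx) hp) hy

lemma toExposed_congr {u u' : StrongDual ℝ E} {c : ℝ} (hc : 0 < c)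
    (h : ∀ y ∈ vectorSpan ℝ P, u' y = c * u y) : u'.toExposed P = u.toExposed P := by
  ext x
  refine and_congr_right fun hx => forall₂_congr fun y hy => ?_
  have := h _ (sub_mem_vectorSpan hx hy)
  rw [map_sub, map_sub] at this
  rw [← sub_nonneg, this, mul_nonneg_iff_of_pos_left hc, sub_nonneg]

lemma IsFace.vectorSpan_lt (hF : IsFace P F) (hne : F ≠ P) :
    vectorSpan ℝ F < vectorSpan ℝ P := by
  refine lt_of_le_of_ne (vectorSpan_mono ℝ hF.subset) fun h => hne ?_
  obtain ⟨⟨p, hp⟩, u, hu⟩ := PolytopeSum.isFace_iff.1 hF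
  have hp' := hp
  rw [hu] at hp'
  rw [hu]
  refine eq_of_mem_toExposed_of_vectorSpan ⟨p, hp'⟩ fun y hy => ?_
  rw [← h] at hy
  exact apply_eq_zero_of_mem_vectorSpan hp
    (fun x hx => apply_eq_of_mem_toExposed (P := P) (hu ▸ hx) hp') hy

lemma dim_singleton (v : E) : dim ({v} : Set E) = 0 := by
  simp [dim]

/-- The faces of dimension `k` of `P`. -/
def facesOfDim (k : ℕ) (P : Set E) : Set (Set E) := {F | IsFace P F ∧ dim F = k}

lemma IsPolytope.finite_facesOfDim (hP : IsPolytope P) (k : ℕ) : (facesOfDim k P).Finite :=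
  hP.finite_faces.subset fun _ h => h.1

lemma facesOfDim_face (hP : IsPolytope P) (hF : IsFace P F) (k : ℕ) :
    facesOfDim k F = {G ∈ facesOfDim k P | G ⊆ F} := by
  ext G
  simp only [facesOfDim, Set.mem_ofPred_eq, hF.isFace_iff hP]
  tauto

lemma nonempty_of_dim_pos (h : 0 < dim P) : P.Nonempty := by
  rw [Set.nonempty_iff_ne_empty]
  rintro rfl
  rw [dim, vectorSpan_empty, finrank_bot] at h
  exact h.false

section FiniteDimensional

variable [FiniteDimensional ℝ E]

lemma IsFace.dim_lt (hF : IsFace P F) (hne : F ≠ P) : dim F < dim P :=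
  Submodule.finrank_lt_finrank_of_lt (hF.vectorSpan_lt hne)

lemma eq_singleton_of_dim_eq_zero (h : dim F = 0) {v : E} (hv : v ∈ F) : F = {v} := by
  have h0 : vectorSpan ℝ F = ⊥ := Submodule.finrank_eq_zero.1 h
  refine Set.Subset.antisymm (fun x hx => ?_) (Set.singleton_subset_iff.2 hv)
  have := sub_mem_vectorSpan hx hv
  rw [h0, Submodule.mem_bot, sub_eq_zero] at this
  exact this

lemma facesOfDim_zero (hP : IsPolytope P) :
    facesOfDim 0 P = (fun v => {v}) '' P.extremePoints ℝ := by
  ext F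
  constructor
  · rintro ⟨hF, h0⟩
    obtain ⟨v, hv⟩ := hF.1
    obtain rfl := eq_singleton_of_dim_eq_zero h0 hv
    exact ⟨v, (isFace_singleton_iff hP).1 hF, rfl⟩
  · rintro ⟨v, hv, rfl⟩
    exact ⟨hP.isFace_singleton hv, dim_singleton v⟩

lemma numFaces_zero (hP : IsPolytope P) : numFaces 0 P = (P.extremePoints ℝ).ncard := by
  have := facesOfDim_zero hP
  rw [numFaces, ← facesOfDim, this, Set.ncard_image_of_injective _ Set.singleton_injective]

end FiniteDimensional

end Basic

/-! ### Facets through a face of codimension two -/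

section Diamond

variable [FiniteDimensional ℝ E] {P Q F G : Set E}

lemma exists_strongDual_of_notMem {T : Submodule ℝ E} {z : E} (hz : z ∉ T) :
    ∃ h : StrongDual ℝ E, (∀ y ∈ T, h y = 0) ∧ h z ≠ 0 := by
  obtain ⟨f, hfz, hf⟩ := T.exists_le_ker_of_notMem hz
  exact ⟨LinearMap.toContinuousLinearMap f, fun y hy => hf hy, hfz⟩

lemma finrank_lt_finrank_sup_span {T : Submodule ℝ E} {z : E} (hz : z ∉ T) :
    Module.finrank ℝ T < Module.finrank ℝ (T ⊔ ℝ ∙ z : Submodule ℝ E) := by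
  refine Submodule.finrank_lt_finrank_of_lt (lt_of_le_of_ne le_sup_left fun h => hz ?_)
  rw [h]
  exact Submodule.mem_sup_right (Submodule.mem_span_singleton_self z)

/-- In codimension two, a functional `g` vanishing on `T` and not on `S` can be completed to a
basis of the functionals on `S` that vanish on `T`. -/
lemma exists_complementary_functional {S T : Submodule ℝ E} (hTS : T ≤ S)
    (hd : Module.finrank ℝ T + 2 = Module.finrank ℝ S) {g : StrongDual ℝ E}
    (hgT : ∀ y ∈ T, g y = 0) (hgS : ∃ y ∈ S, g y ≠ 0) :
    ∃ h : StrongDual ℝ E, (∀ y ∈ T, h y = 0) ∧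
      (∀ u : StrongDual ℝ E, (∀ y ∈ T, u y = 0) →
        ∃ a b : ℝ, ∀ y ∈ S, u y = a * g y + b * h y) ∧
      ∀ a b : ℝ, (∀ y ∈ S, a * g y + b * h y = 0) → b = 0 := by
  obtain ⟨x, hxS, hgx⟩ := hgS
  have hxT : x ∉ T := fun hx => hgx (hgT x hx)
  have hU : T ⊔ ℝ ∙ x ≤ S :=
    sup_le hTS ((Submodule.span_singleton_le_iff_mem x S).2 hxS)
  have hUd : Module.finrank ℝ (T ⊔ ℝ ∙ x : Submodule ℝ E) < Module.finrank ℝ S := by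
    have h1 := Submodule.finrank_add_le_finrank_add_finrank T (ℝ ∙ x)
    have h2 : Module.finrank ℝ (ℝ ∙ x) ≤ 1 :=
      (finrank_span_singleton fun h0 => hgx (by rw [h0, map_zero])).le
    omega
  obtain ⟨z₀, hz₀S, hz₀⟩ : ∃ z ∈ S, z ∉ T ⊔ ℝ ∙ x := by
    by_contra! hcon
    exact hUd.not_ge (Submodule.finrank_mono hcon)
  -- Correcting `z₀` by a multiple of `x` makes `g` vanish at `z`, so the coefficients of `u` can be
  -- read off triangularly: `b` at `z`, then `a` at `x`.
  obtain ⟨z, hzS, hz, hgz⟩ : ∃ z ∈ S, z ∉ T ⊔ ℝ ∙ x ∧ g z = 0 := by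
    have hx : (g z₀ / g x) • x ∈ T ⊔ ℝ ∙ x :=
      Submodule.smul_mem _ _ (Submodule.mem_sup_right (Submodule.mem_span_singleton_self x))
    refine ⟨z₀ - (g z₀ / g x) • x, S.sub_mem hz₀S (S.smul_mem _ hxS), fun h => hz₀ ?_, ?_⟩
    · simpa using add_mem h hx
    · simp [hgx]
  have hzT : z ∉ T := fun h => hz (Submodule.mem_sup_left h)
  obtain ⟨h, hhT, hhz⟩ := exists_strongDual_of_notMem hzT
  have hS : T ⊔ ℝ ∙ x ⊔ ℝ ∙ z = S := by
    refine Submodule.eq_of_le_of_finrank_le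
      (sup_le hU ((Submodule.span_singleton_le_iff_mem z S).2 hzS)) ?_
    have h1 := finrank_lt_finrank_sup_span hxT
    have h2 := finrank_lt_finrank_sup_span hz
    omega
  refine ⟨h, hhT, fun u hu => ?_, fun a b hab => ?_⟩
  · set b := u z / h z
    set a := (u x - b * h x) / g x
    refine ⟨a, b, fun y hy => ?_⟩
    have hle : S ≤ LinearMap.ker (u - a • g - b • h).toLinearMap := by
      rw [← hS]
      refine sup_le (sup_le (fun y hy => ?_) ?_) ?_
      · simp [hu y hy, hgT y hy, hhT y hy]
      · rw [Submodule.span_singleton_le_iff_mem]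
        have : a * g x = u x - b * h x := div_mul_cancel₀ _ hgx
        simp [this]
      · rw [Submodule.span_singleton_le_iff_mem]
        have : b * h z = u z := div_mul_cancel₀ _ hhz
        simp [this, hgz]
    have h0 : u y - a * g y - b * h y = 0 := by simpa using hle hy
    linarith
  · have := hab z hzS
    rw [hgz, mul_zero, zero_add] at this
    exact (mul_eq_zero.1 this).resolve_right hhz

/-- The functionals exposing a facet are positive multiples of each other. -/
lemma exists_pos_mul_of_toExposed_eq (hF : F.Nonempty) (hd : dim F + 1 = dim P)
    {u u' : StrongDual ℝ E} (hu : F = u.toExposed P) (hu' : F = u'.toExposed P) :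
    ∃ c : ℝ, 0 < c ∧ ∀ y ∈ vectorSpan ℝ P, u' y = c * u y := by
  obtain ⟨p, hp⟩ := hF
  have hFP : F ⊆ P := hu ▸ fun x hx => hx.1
  obtain ⟨x, hxP, hxF⟩ : ∃ x ∈ P, x ∉ F := by
    by_contra! hcon
    have := hFP.antisymm hcon
    rw [this] at hd
    omega
  have h1 : u x < u p := apply_lt_of_notMem_toExposed (hu ▸ hp) hxP (hu ▸ hxF)
  have h2 : u' x < u' p := apply_lt_of_notMem_toExposed (hu' ▸ hp) hxP (hu' ▸ hxF)
  have hz : ∀ y ∈ vectorSpan ℝ F, u y = 0 := fun y hy => apply_eq_zero_of_mem_vectorSpan hp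
    (fun z hz => apply_eq_of_mem_toExposed (P := P) (hu ▸ hz) (hu ▸ hp)) hy
  have hz' : ∀ y ∈ vectorSpan ℝ F, u' y = 0 := fun y hy => apply_eq_zero_of_mem_vectorSpan hp
    (fun z hz => apply_eq_of_mem_toExposed (P := P) (hu' ▸ hz) (hu' ▸ hp)) hy
  have hxp : x - p ∉ vectorSpan ℝ F := fun h => by
    have := hz _ h
    rw [map_sub] at this
    linarith
  have hS : vectorSpan ℝ F ⊔ ℝ ∙ (x - p) = vectorSpan ℝ P := by
    refine Submodule.eq_of_le_of_finrank_le (sup_le (vectorSpan_mono ℝ hFP)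
      ((Submodule.span_singleton_le_iff_mem _ _).2 (sub_mem_vectorSpan hxP (hFP hp)))) ?_
    have := finrank_lt_finrank_sup_span hxp
    simp only [dim] at hd
    omega
  refine ⟨(u' x - u' p) / (u x - u p), div_pos_of_neg_of_neg (by linarith) (by linarith), ?_⟩
  set c := (u' x - u' p) / (u x - u p)
  intro y hy
  have hle : vectorSpan ℝ P ≤ LinearMap.ker (u' - c • u).toLinearMap := by
    rw [← hS]
    refine sup_le (fun y hy => ?_) ?_
    · simp [hz y hy, hz' y hy]
    · rw [Submodule.span_singleton_le_iff_mem]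
      have : c * (u x - u p) = u' x - u' p := div_mul_cancel₀ _ (by linarith)
      simp [this]
  have h0 : u' y - c * u y = 0 := by simpa using hle hy
  linarith

omit [FiniteDimensional ℝ E] in
/-- Tilting the functional `g` exposing `G` in the direction `h` until it exposes a larger face. -/
lemma exists_tilt (hQ : IsPolytope Q) {g h : StrongDual ℝ E} {p : E} (hp : p ∈ g.toExposed Q)
    (hne : g.toExposed Q ≠ Q) (hh : ∀ x ∈ g.toExposed Q, h x = h p) :
    ∃ M : ℝ, g.toExposed Q ⊆ (M • g + h).toExposed Q ∧
      ∃ w ∈ (M • g + h).toExposed Q, w ∉ g.toExposed Q := by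
  have hface := isFace_toExposed ⟨p, hp⟩
  have hfin : (Q.extremePoints ℝ \ g.toExposed Q).Finite :=
    hQ.finite_extremePoints.subset Set.sdiff_subset
  obtain ⟨w₀, hw₀⟩ : (Q.extremePoints ℝ \ g.toExposed Q).Nonempty := by
    rw [Set.nonempty_iff_ne_empty, Ne, Set.sdiff_eq_empty]
    exact fun hsub => hne (hface.subset.antisymm
      (hQ.subset_of_extremePoints_subset (hface.2.convex hQ.convex) hsub))
  -- The ratio is the coefficient of `g` at which `w` ties with `p`. With the largest one no vertex
  -- beats `p`, and the maximizer `w₁` joins the face.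
  obtain ⟨w₁, hw₁, hmax⟩ := hfin.exists_maximalFor (fun w => (h w - h p) / (g p - g w)) _
    ⟨w₀, hw₀⟩
  have hlt : ∀ w ∈ Q.extremePoints ℝ \ g.toExposed Q, 0 < g p - g w := fun w hw =>
    sub_pos.2 (apply_lt_of_notMem_toExposed hp hw.1.1 hw.2)
  set M := (h w₁ - h p) / (g p - g w₁) with hM
  have hle : ∀ w ∈ Q.extremePoints ℝ \ g.toExposed Q, h w - h p ≤ M * (g p - g w) := by
    intro w hw
    rw [← div_le_iff₀ (hlt w hw)]
    rcases le_total ((h w - h p) / (g p - g w)) M with h1 | h1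
    exacts [h1, hmax hw h1]
  have heq : h w₁ - h p = M * (g p - g w₁) := (div_mul_cancel₀ _ (hlt w₁ hw₁).ne').symm
  have hG : ∀ x ∈ g.toExposed Q, (M • g + h) x = (M • g + h) p := fun x hx => by
    simp [hh x hx, apply_eq_of_mem_toExposed hx hp]
  have hpM : p ∈ (M • g + h).toExposed Q := by
    refine hQ.mem_toExposed hp.1 fun w hw => ?_
    by_cases hwG : w ∈ g.toExposed Q
    · exact (hG w hwG).le
    · have := hle w ⟨hw, hwG⟩
      simp only [add_apply, smul_apply, smul_eq_mul]
      linarith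
  refine ⟨M, fun x hx => mem_toExposed_of_apply_eq hpM hx.1 (hG x hx), w₁,
    mem_toExposed_of_apply_eq hpM hw₁.1.1 ?_, hw₁.2⟩
  simp only [add_apply, smul_apply, smul_eq_mul]
  linarith

omit [FiniteDimensional ℝ E] in
-- There is one critical tilt: comparing values at `w₁` gives `a ≤ b * M`, at `w₀` the reverse, so
-- on the direction space of `Q` the functional `u` is `b` times `M • g + h`.
lemma tilt_unique {g h u : StrongDual ℝ E} {p w₀ w₁ : E} {M a b : ℝ} (hb : 0 < b)
    (hp : p ∈ g.toExposed Q) (hpM : p ∈ (M • g + h).toExposed Q)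
    (hw₀ : w₀ ∈ (M • g + h).toExposed Q) (hw₀' : w₀ ∉ g.toExposed Q)
    (hpu : p ∈ u.toExposed Q) (hw₁ : w₁ ∈ u.toExposed Q) (hw₁' : w₁ ∉ g.toExposed Q)
    (hu : ∀ y ∈ vectorSpan ℝ Q, u y = a * g y + b * h y) :
    u.toExposed Q = (M • g + h).toExposed Q := by
  have h0 := apply_lt_of_notMem_toExposed hp hw₀.1 hw₀'
  have h1 := apply_lt_of_notMem_toExposed hp hw₁.1 hw₁'
  have e0 := apply_eq_of_mem_toExposed hw₀ hpM
  have e1 := apply_eq_of_mem_toExposed hw₁ hpu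
  have l0 := hpu.2 w₀ hw₀.1
  have l1 := hpM.2 w₁ hw₁.1
  have u0 := hu _ (sub_mem_vectorSpan hw₀.1 hp.1)
  have u1 := hu _ (sub_mem_vectorSpan hw₁.1 hp.1)
  simp only [add_apply, smul_apply, smul_eq_mul, map_sub] at e0 e1 l0 l1 u0 u1
  have ha : a = b * M := by
    apply le_antisymm
    · have : 0 ≤ (b * M - a) * (g p - g w₁) := by nlinarith
      linarith [nonneg_of_mul_nonneg_left this (by linarith)]
    · have : 0 ≤ (a - b * M) * (g p - g w₀) := by
        have : b * (M * g w₀ + h w₀) = b * (M * g p + h p) := by rw [e0]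
        nlinarith
      linarith [nonneg_of_mul_nonneg_left this (by linarith)]
  refine toExposed_congr hb fun y hy => ?_
  simp only [hu y hy, ha, add_apply, smul_apply, smul_eq_mul]
  ring

/-- A face of codimension two lies in exactly two facets. -/
theorem ncard_facets_containing (hQ : IsPolytope Q) (hG : IsFace Q G) (hd : dim G + 2 = dim Q) :
    {F ∈ facesOfDim (dim G + 1) Q | G ⊆ F}.ncard = 2 := by
  obtain ⟨⟨p, hp⟩, g, rfl⟩ := isFace_iff.1 hG
  have hne : g.toExposed Q ≠ Q := fun h => by rw [h] at hd; omega
  have hgT : ∀ {u : StrongDual ℝ E}, g.toExposed Q ⊆ u.toExposed Q →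
      ∀ y ∈ vectorSpan ℝ (g.toExposed Q), u y = 0 := fun hu y hy =>
    apply_eq_zero_of_mem_vectorSpan hp
      (fun x hx => apply_eq_of_mem_toExposed (hu hx) (hu hp)) hy
  have hgS : ∃ y ∈ vectorSpan ℝ Q, g y ≠ 0 := by
    by_contra! hcon
    exact hne (eq_of_mem_toExposed_of_vectorSpan ⟨p, hp⟩ hcon)
  obtain ⟨h, hhT, hspan, hind⟩ := exists_complementary_functional
    (vectorSpan_mono ℝ hG.subset) hd (hgT subset_rfl) hgS
  have hh : ∀ x ∈ g.toExposed Q, h x = h p := fun x hx => by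
    have := hhT _ (sub_mem_vectorSpan hx hp)
    rw [map_sub] at this
    linarith
  -- Tilting towards `h` and towards `-h` produces the two facets.
  obtain ⟨M, hM, w, hwM, hwG⟩ := exists_tilt hQ hp hne hh
  obtain ⟨N, hN, z, hzN, hzG⟩ := exists_tilt hQ (h := -h) hp hne (by simpa using hh)
  have hfacet : ∀ {u : StrongDual ℝ E} {x : E} {a b : ℝ}, g.toExposed Q ⊆ u.toExposed Q →
      x ∈ u.toExposed Q → x ∉ g.toExposed Q → (∀ y ∈ vectorSpan ℝ Q, u y = a * g y + b * h y) →
      b ≠ 0 → dim (u.toExposed Q) = dim (g.toExposed Q) + 1 := by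
    intro u x a b hu hxu hxg hab hb
    have hface := isFace_toExposed ⟨x, hxu⟩
    have h1 := (hG.mono hface.subset hu).dim_lt fun he => hxg (he ▸ hxu)
    have h2 := hface.dim_lt fun he => hb (hind a b fun y hy => by
      rw [← hab y hy]
      exact (toExposed_eq_self_iff ⟨x, hxu⟩).1 he y hy)
    omega
  have hdM := hfacet (a := M) (b := 1) hM hwM hwG (by simp) one_ne_zero
  have hdN := hfacet (a := N) (b := -1) hN hzN hzG (by simp) (by norm_num)
  have hMN : (M • g + h).toExposed Q ≠ (N • g + -h).toExposed Q := by
    intro he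
    obtain ⟨c, hc, hcu⟩ := exists_pos_mul_of_toExposed_eq ⟨w, hwM⟩ (by omega) rfl he
    have : -1 - c = 0 := hind (N - c * M) _ fun y hy => by
      have := hcu y hy
      simp only [add_apply, smul_apply, smul_eq_mul, neg_apply] at this
      linarith
    linarith
  rw [← Set.ncard_pair hMN]
  congr 1
  ext F
  simp only [facesOfDim, Set.mem_ofPred_eq, Set.mem_insert_iff, Set.mem_singleton_iff]
  constructor
  · rintro ⟨⟨hF, hFd⟩, hGF⟩
    obtain ⟨-, u, rfl⟩ := isFace_iff.1 hF
    obtain ⟨a, b, hab⟩ := hspan u (hgT hGF)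
    obtain ⟨x, hxu, hxg⟩ : ∃ x ∈ u.toExposed Q, x ∉ g.toExposed Q := by
      by_contra! hcon
      rw [hGF.antisymm hcon] at hFd
      omega
    -- The sign of `b` decides which of the two facets `u` exposes; `b = 0` would make `u` constant
    -- on `Q`.
    rcases lt_trichotomy b 0 with hb | rfl | hb
    · right
      exact tilt_unique (a := a) (neg_pos.2 hb) hp (hN hp) hzN hzG (hGF hp) hxu hxg
        (fun y hy => by simp [hab y hy])
    · exfalso
      have h1 := hab _ (sub_mem_vectorSpan hxu.1 hp.1)
      have h2 := apply_eq_of_mem_toExposed hxu (hGF hp)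
      have h3 := apply_lt_of_notMem_toExposed hp hxu.1 hxg
      rw [map_sub, map_sub, h2, sub_self, zero_mul, add_zero, eq_comm, mul_eq_zero] at h1
      have ha : a = 0 := h1.resolve_right (by linarith)
      have : u.toExposed Q = Q := eq_of_mem_toExposed_of_vectorSpan ⟨x, hxu⟩ fun y hy => by
        simp [hab y hy, ha]
      rw [this] at hFd
      omega
    · left
      exact tilt_unique hb hp (hM hp) hwM hwG (hGF hp) hxu hxg hab
  · rintro (rfl | rfl)
    exacts [⟨⟨isFace_toExposed ⟨w, hwM⟩, hdM⟩, hM⟩, ⟨⟨isFace_toExposed ⟨z, hzN⟩, hdN⟩, hN⟩]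

/-- A one-dimensional polytope has exactly two vertices. -/
theorem ncard_extremePoints_of_dim_eq_one (hQ : IsPolytope Q) (hd : dim Q = 1) :
    (Q.extremePoints ℝ).ncard = 2 := by
  have hQne : Q.Nonempty := nonempty_of_dim_pos (by omega)
  obtain ⟨⟨x, hxS⟩, hx0, hx⟩ := finrank_eq_one_iff'.1 hd
  have hx0' : x ≠ 0 := fun h => hx0 (Subtype.ext h)
  obtain ⟨f, -, hfx⟩ := exists_strongDual_of_notMem (T := ⊥) (z := x) (by simpa using hx0')
  -- On a line every functional is a multiple of `f`, so the only proper faces are those exposed by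
  -- `f` and `-f`.
  have hmul : ∀ (u : StrongDual ℝ E), ∀ y ∈ vectorSpan ℝ Q, u y = (u x / f x) * f y := by
    intro u y hy
    obtain ⟨c, hc⟩ := hx ⟨y, hy⟩
    have hc' : c • x = y := congrArg Subtype.val hc
    rw [← hc']
    simp only [map_smul, smul_eq_mul]
    field_simp
  have hface : ∀ u : StrongDual ℝ E, IsFace Q (u.toExposed Q) := fun u =>
    isFace_toExposed (hQ.nonempty_toExposed hQne u)
  have hdim : ∀ u : StrongDual ℝ E, u x ≠ 0 → dim (u.toExposed Q) = 0 := by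
    intro u hu
    have := (hface u).dim_lt fun he => hu ((toExposed_eq_self_iff (hface u).1).1 he x hxS)
    omega
  have hne : f.toExposed Q ≠ (-f).toExposed Q := by
    intro he
    obtain ⟨p, hp⟩ := (hface f).1
    have hp' : p ∈ (-f).toExposed Q := he ▸ hp
    refine hfx ((toExposed_eq_self_iff (hface f).1).1 ?_ x hxS)
    refine (hface f).subset.antisymm fun y hy => mem_toExposed_of_apply_eq hp hy ?_
    have h1 := hp.2 y hy
    have h2 := hp'.2 y hy
    simp only [neg_apply] at h2
    linarith
  rw [← numFaces_zero hQ, numFaces, ← Set.ncard_pair hne]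
  congr 1
  ext F
  simp only [Set.mem_ofPred_eq, Set.mem_insert_iff, Set.mem_singleton_iff]
  constructor
  · rintro ⟨hF, hF0⟩
    obtain ⟨-, u, rfl⟩ := isFace_iff.1 hF
    rcases lt_trichotomy (u x / f x) 0 with hb | hb | hb
    · right
      exact toExposed_congr (neg_pos.2 hb) fun y hy => by rw [hmul u y hy]; simp
    · exfalso
      rw [eq_of_mem_toExposed_of_vectorSpan hF.1 fun y hy => by rw [hmul u y hy, hb, zero_mul]]
        at hF0
      omega
    · left
      exact toExposed_congr hb (hmul u)
  · rintro (rfl | rfl)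
    exacts [⟨hface _, hdim _ hfx⟩, ⟨hface _, hdim _ (by simpa using hfx)⟩]

end Diamond

/-! ### Double counting and generic functionals -/

section Counting

lemma sum_ncard_comm {α β : Type*} {A : Set α} {B : Set β} (hA : A.Finite) (hB : B.Finite)
    (r : α → β → Prop) :
    ∑ a ∈ hA.toFinset, {b ∈ B | r a b}.ncard = ∑ b ∈ hB.toFinset, {a ∈ A | r a b}.ncard := by
  classical
  have h := Finset.sum_card_bipartiteAbove_eq_sum_card_bipartiteBelow r
    (s := hA.toFinset) (t := hB.toFinset)
  convert h using 2 with a _ b _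
  · rw [← Set.ncard_coe_finset]
    congr 1
    ext b
    simp
  · rw [← Set.ncard_coe_finset]
    congr 1
    ext a
    simp

lemma ncard_between_add_two {α : Type*} {T : Set α} {f : α → ℝ} (hf : Set.InjOn f T)
    (hT : 2 ≤ T.ncard) :
    {x ∈ T | ∃ w ∈ T, ∃ w' ∈ T, f w' < f x ∧ f x < f w}.ncard + 2 = T.ncard := by
  have hfin : T.Finite := Set.finite_of_ncard_pos (by omega)
  have hne : T.Nonempty := Set.nonempty_of_ncard_ne_zero (by omega)
  obtain ⟨M, hM, hmax⟩ := Set.exists_max_image T f hfin hne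
  obtain ⟨m, hm, hmin⟩ := Set.exists_min_image T f hfin hne
  have hmM : m ≠ M := by
    rintro rfl
    have : T ⊆ {m} := fun x hx => hf hx hm ((hmax x hx).antisymm (hmin x hx))
    have := Set.ncard_le_ncard this
    rw [Set.ncard_singleton] at this
    omega
  have hsub : ({m, M} : Set α) ⊆ T := by
    rintro x (rfl | rfl)
    exacts [hm, hM]
  rw [← Set.ncard_sdiff_add_ncard_of_subset hsub hfin, Set.ncard_pair hmM]
  congr 2
  ext x
  simp only [Set.mem_ofPred_eq, Set.mem_sdiff, Set.mem_insert_iff, Set.mem_singleton_iff, not_or]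
  refine and_congr_right fun hx => ⟨?_, fun h => ⟨M, hM, m, hm, ?_, ?_⟩⟩
  · rintro ⟨w, hw, w', hw', h1, h2⟩
    exact ⟨by rintro rfl; exact h1.not_ge (hmin w' hw'),
      by rintro rfl; exact h2.not_ge (hmax w hw)⟩
  · exact lt_of_le_of_ne (hmin x hx) fun e => h.1 (hf hx hm e.symm)
  · exact lt_of_le_of_ne (hmax x hx) fun e => h.2 (hf hx hM e)

/-- A generic functional is nonzero on the finitely many differences of distinct points of `S`. -/
lemma exists_strongDual_injOn [FiniteDimensional ℝ E] {S : Set E} (hS : S.Finite) :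
    ∃ l : StrongDual ℝ E, Set.InjOn l S := by
  have : Finite S := hS
  obtain ⟨f, hf⟩ := Module.exists_dual_forall_apply_ne_zero (K := ℝ)
    (fun q : {q : S × S // (q.1 : E) ≠ q.2} => (q.1.1 : E) - q.1.2) fun q => sub_ne_zero.2 q.2
  refine ⟨LinearMap.toContinuousLinearMap f, fun x hx y hy hxy => ?_⟩
  by_contra hne
  refine hf ⟨(⟨x, hx⟩, ⟨y, hy⟩), hne⟩ ?_
  rw [map_sub, sub_eq_zero]
  exact hxy

end Counting

/-! ### Euler's formula by a sweep -/

section Euler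

variable [FiniteDimensional ℝ E] {P Q F G : Set E}

omit [FiniteDimensional ℝ E] in
lemma two_le_ncard_extremePoints (hQ : IsPolytope Q) (hd : 0 < dim Q) :
    2 ≤ (Q.extremePoints ℝ).ncard := by
  have hne := hQ.nonempty_extremePoints (nonempty_of_dim_pos hd)
  have h0 := (Set.ncard_pos hQ.finite_extremePoints).2 hne
  by_contra! hlt
  obtain ⟨v, hv⟩ := Set.ncard_eq_one.1 (show (Q.extremePoints ℝ).ncard = 1 by omega)
  have := hQ.convexHull_extremePoints
  rw [hv, convexHull_singleton] at this
  rw [← this, dim_singleton] at hd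
  exact hd.false

/-- A polygon has as many vertices as edges. -/
theorem numFaces_zero_eq_numFaces_one (hQ : IsPolytope Q) (hd : dim Q = 2) :
    numFaces 0 Q = numFaces 1 Q := by
  have h := sum_ncard_comm hQ.finite_extremePoints (hQ.finite_facesOfDim 1) (fun v e => v ∈ e)
  have h1 : ∀ v ∈ hQ.finite_extremePoints.toFinset,
      {e ∈ facesOfDim 1 Q | v ∈ e}.ncard = 2 := by
    intro v hv
    have hv' : v ∈ Q.extremePoints ℝ := by simpa using hv
    have := ncard_facets_containing hQ (hQ.isFace_singleton hv') (by rw [dim_singleton, hd])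
    simpa [dim_singleton] using this
  have h2 : ∀ e ∈ (hQ.finite_facesOfDim 1).toFinset,
      {v ∈ Q.extremePoints ℝ | v ∈ e}.ncard = 2 := by
    intro e he
    have he' : e ∈ facesOfDim 1 Q := by simpa using he
    rw [← ncard_extremePoints_of_dim_eq_one (he'.1.isPolytope hQ) he'.2, he'.1.extremePoints_eq]
    congr 1
    ext v
    simp [and_comm]
  rw [Finset.sum_const_nat h1, Finset.sum_const_nat h2,
    ← Set.ncard_eq_toFinset_card _ hQ.finite_extremePoints,
    ← Set.ncard_eq_toFinset_card _ (hQ.finite_facesOfDim 1)] at h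
  rw [numFaces_zero hQ, numFaces, ← facesOfDim]
  omega

/-- Double counting the flags of edges and facets of a three-dimensional polytope. -/
theorem two_mul_numFaces_one (hP : IsPolytope P) (hd : dim P = 3) :
    2 * numFaces 1 P = ∑ F ∈ (hP.finite_facesOfDim 2).toFinset, numFaces 0 F := by
  have h := sum_ncard_comm (hP.finite_facesOfDim 1) (hP.finite_facesOfDim 2) (fun e F => e ⊆ F)
  have h1 : ∀ e ∈ (hP.finite_facesOfDim 1).toFinset,
      {F ∈ facesOfDim 2 P | e ⊆ F}.ncard = 2 := by
    intro e he
    have he' : e ∈ facesOfDim 1 P := by simpa using he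
    have := ncard_facets_containing hP he'.1 (by rw [he'.2, hd])
    rwa [he'.2] at this
  rw [Finset.sum_const_nat h1, ← Set.ncard_eq_toFinset_card _ (hP.finite_facesOfDim 1),
    mul_comm] at h
  rw [numFaces, ← facesOfDim, h]
  refine Finset.sum_congr rfl fun F hF => ?_
  have hF' : F ∈ facesOfDim 2 P := by simpa using hF
  rw [numFaces_zero_eq_numFaces_one (hF'.1.isPolytope hP) hF'.2, numFaces, ← facesOfDim,
    facesOfDim_face hP hF'.1]

/-- The vertices of `F` that are neither the highest nor the lowest with respect to `l`. -/
def middleVertices (l : StrongDual ℝ E) (F : Set E) : Set E :=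
  {v ∈ F.extremePoints ℝ | ∃ w ∈ F.extremePoints ℝ, ∃ w' ∈ F.extremePoints ℝ,
    l w' < l v ∧ l v < l w}

omit [FiniteDimensional ℝ E] in
/-- Tilting a functional exposing the vertex `v` so that it exposes a face with a vertex above
and a vertex below `v`. -/
lemma exists_tilt_across (hP : IsPolytope P) {l g : StrongDual ℝ E}
    (hl : Set.InjOn l (P.extremePoints ℝ)) {v : E} (hv : v ∈ middleVertices l P)
    (hg : ∀ w ∈ P, w ≠ v → g w < g v) (h : StrongDual ℝ E) :
    ∃ M t : ℝ, v ∈ (M • g + h + t • l).toExposed P ∧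
      (∃ w ∈ P.extremePoints ℝ, w ∈ (M • g + h + t • l).toExposed P ∧ l v < l w) ∧
      ∃ w ∈ P.extremePoints ℝ, w ∈ (M • g + h + t • l).toExposed P ∧ l w < l v := by
  obtain ⟨hvP, w, hw, w', hw', hlw', hlw⟩ := hv
  let X : Set (E × E) := {q | (q.1 ∈ P.extremePoints ℝ ∧ l v < l q.1) ∧
    q.2 ∈ P.extremePoints ℝ ∧ l q.2 < l v}
  have hX : X.Finite := (hP.finite_extremePoints.prod hP.finite_extremePoints).subset
    fun q hq => ⟨hq.1.1, hq.2.1⟩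
  -- `φ k q` is the value of `k` at a positive combination of `q.1 - v` and `q.2 - v` lying in the
  -- kernel of `l`. Adding multiples of `l` to `k` does not change it, so `M` can be fixed before
  -- `t`.
  let φ : StrongDual ℝ E → E × E → ℝ := fun k q =>
    (l v - l q.2) * (k q.1 - k v) + (l q.1 - l v) * (k q.2 - k v)
  have hφg : ∀ q ∈ X, φ g q < 0 := by
    rintro q ⟨⟨h1, h2⟩, h3, h4⟩
    have e1 := hg q.1 h1.1 (by rintro e; rw [e] at h2; exact h2.false)
    have e2 := hg q.2 h3.1 (by rintro e; rw [e] at h4; exact h4.false)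
    exact add_neg (mul_neg_of_pos_of_neg (by linarith) (by linarith))
      (mul_neg_of_pos_of_neg (by linarith) (by linarith))
  -- The largest ratio makes `φ k` nonpositive on all pairs and zero at `q`; then `t` is chosen so
  -- that `q.1` ties with `v`, and `φ k q = 0` makes `q.2` tie as well.
  obtain ⟨q, hq, hmax⟩ := Set.exists_max_image X (fun q => φ h q / -φ g q) hX
    ⟨(w, w'), ⟨hw, hlw⟩, hw', hlw'⟩
  set M := φ h q / -φ g q with hM
  set k := M • g + h with hk
  have hφk : ∀ r, φ k r = M * φ g r + φ h r := by
    intro r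
    simp only [φ, hk, add_apply, smul_apply, smul_eq_mul]
    ring
  have hle : ∀ r ∈ X, φ k r ≤ 0 := by
    intro r hr
    have := hmax r hr
    rw [div_le_iff₀ (neg_pos.2 (hφg r hr))] at this
    rw [hφk]
    linarith
  have heq : φ k q = 0 := by
    have : M * -φ g q = φ h q := div_mul_cancel₀ _ (neg_pos.2 (hφg q hq)).ne'
    rw [hφk]
    linarith
  obtain ⟨⟨hq1, hlq1⟩, hq2, hlq2⟩ := hq
  set t := -(k q.1 - k v) / (l q.1 - l v) with ht
  have ht1 : t * (l q.1 - l v) = -(k q.1 - k v) := div_mul_cancel₀ _ (by linarith)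
  have ht2 : t * (l v - l q.2) = k q.2 - k v := by
    have hpos : l q.1 - l v ≠ 0 := by linarith
    apply mul_right_cancel₀ hpos
    simp only [φ] at heq
    linear_combination (l v - l q.2) * ht1 - heq
  have hvt : v ∈ (k + t • l).toExposed P := by
    refine hP.mem_toExposed hvP.1 fun x hx => ?_
    change k x + t * l x ≤ k v + t * l v
    clear_value t
    rcases lt_trichotomy (l x) (l v) with hlt | he | hgt
    · have h1 : φ k (q.1, x) ≤ 0 := hle _ ⟨⟨hq1, hlq1⟩, hx, hlt⟩
      simp only [φ] at h1
      have h2 : (l q.1 - l v) * (k x - k v - t * (l v - l x)) ≤ 0 := by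
        linear_combination h1 - (l v - l x) * ht1
      have := nonpos_of_mul_nonpos_right h2 (by linarith)
      linarith
    · rw [hl hx hvP he]
    · have h1 : φ k (x, q.2) ≤ 0 := hle _ ⟨⟨hx, hgt⟩, hq2, hlq2⟩
      simp only [φ] at h1
      have h2 : (l v - l q.2) * (k x - k v + t * (l x - l v)) ≤ 0 := by
        linear_combination h1 + (l x - l v) * ht2
      have := nonpos_of_mul_nonpos_right h2 (by linarith)
      linarith
  refine ⟨M, t, hvt, ⟨q.1, hq1, mem_toExposed_of_apply_eq hvt hq1.1 ?_, hlq1⟩,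
    q.2, hq2, mem_toExposed_of_apply_eq hvt hq2.1 ?_, hlq2⟩
  · change k q.1 + t * l q.1 = k v + t * l v
    linarith
  · change k q.2 + t * l q.2 = k v + t * l v
    linarith

omit [FiniteDimensional ℝ E] in
-- Relative to `v`, the difference of `b` times the tilted functional and `u` is `A g + C l`. It is
-- nonnegative at `w₀, z₀` and nonpositive at `w₁, z₁`. Each pair straddles `v` in `l`, while `g` is
-- largest at `v`: this forces `A = 0`, and then `C = 0`.
lemma tilt_across_unique {l g h u : StrongDual ℝ E} {v w₀ z₀ w₁ z₁ : E} {M t a b c : ℝ}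
    (hb : 0 < b) (hg : ∀ w ∈ P, w ≠ v → g w < g v)
    (hv : v ∈ (M • g + h + t • l).toExposed P)
    (hw₀ : w₀ ∈ (M • g + h + t • l).toExposed P) (hlw₀ : l v < l w₀)
    (hz₀ : z₀ ∈ (M • g + h + t • l).toExposed P) (hlz₀ : l z₀ < l v)
    (hvu : v ∈ u.toExposed P) (hw₁ : w₁ ∈ u.toExposed P) (hlw₁ : l v < l w₁)
    (hz₁ : z₁ ∈ u.toExposed P) (hlz₁ : l z₁ < l v)
    (hu : ∀ y, u y = a * g y + b * h y + c * l y) :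
    u.toExposed P = (M • g + h + t • l).toExposed P := by
  have hne : ∀ {x : E}, l x < l v ∨ l v < l x → x ≠ v := by
    rintro x (h | h) rfl <;> exact h.false
  have gw₀ := hg w₀ hw₀.1 (hne (.inr hlw₀))
  have gz₀ := hg z₀ hz₀.1 (hne (.inl hlz₀))
  have gw₁ := hg w₁ hw₁.1 (hne (.inr hlw₁))
  have gz₁ := hg z₁ hz₁.1 (hne (.inl hlz₁))
  set k := M • g + h + t • l with hk
  have hdiff : ∀ y, b * (k y - k v) - (u y - u v) =
      (b * M - a) * (g y - g v) + (b * t - c) * (l y - l v) := by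
    intro y
    simp only [hk, hu, add_apply, smul_apply, smul_eq_mul]
    ring
  have dw₀ := hdiff w₀
  have dz₀ := hdiff z₀
  have dw₁ := hdiff w₁
  have dz₁ := hdiff z₁
  rw [apply_eq_of_mem_toExposed hw₀ hv] at dw₀
  rw [apply_eq_of_mem_toExposed hz₀ hv] at dz₀
  rw [apply_eq_of_mem_toExposed hw₁ hvu] at dw₁
  rw [apply_eq_of_mem_toExposed hz₁ hvu] at dz₁
  have uw₀ := hvu.2 w₀ hw₀.1
  have uz₀ := hvu.2 z₀ hz₀.1
  have kw₁ := mul_le_mul_of_nonneg_left (hv.2 w₁ hw₁.1) hb.le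
  have kz₁ := mul_le_mul_of_nonneg_left (hv.2 z₁ hz₁.1) hb.le
  obtain ⟨A, hA⟩ : ∃ A, A = b * M - a := ⟨_, rfl⟩
  obtain ⟨C, hC⟩ : ∃ C, C = b * t - c := ⟨_, rfl⟩
  rw [← hA, ← hC] at dw₀ dz₀ dw₁ dz₁
  have hA0 : A = 0 := by
    rcases lt_trichotomy A 0 with hneg | h0 | hpos
    · exfalso
      have h1 := mul_pos_of_neg_of_neg hneg (sub_neg.2 gw₁)
      have h2 := mul_pos_of_neg_of_neg hneg (sub_neg.2 gz₁)
      have h3 : C * (l w₁ - l v) < 0 := by linarith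
      have h4 : C * (l v - l z₁) > 0 := by linarith
      have h5 := pos_of_mul_pos_left h4 (by linarith)
      exact h3.not_ge (mul_nonneg h5.le (by linarith))
    · exact h0
    · exfalso
      have h1 := mul_neg_of_pos_of_neg hpos (sub_neg.2 gw₀)
      have h2 := mul_neg_of_pos_of_neg hpos (sub_neg.2 gz₀)
      have h3 : C * (l w₀ - l v) > 0 := by linarith
      have h4 : C * (l v - l z₀) < 0 := by linarith
      have h5 := pos_of_mul_pos_left h3 (by linarith)
      exact h4.not_ge (mul_nonneg h5.le (by linarith))
  have hC0 : C = 0 := by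
    rw [hA0, zero_mul, zero_add] at dw₀ dw₁
    have h1 : 0 ≤ C * (l w₀ - l v) := by linarith
    have h2 : 0 ≤ -C * (l w₁ - l v) := by linarith
    have h3 := nonneg_of_mul_nonneg_left h1 (by linarith)
    have h4 := nonneg_of_mul_nonneg_left h2 (by linarith)
    linarith
  refine toExposed_congr hb fun y _ => ?_
  rw [hA0, eq_comm, sub_eq_zero] at hA
  rw [hC0, eq_comm, sub_eq_zero] at hC
  simp only [hk, hu, add_apply, smul_apply, smul_eq_mul, ← hA, ← hC]
  ring

/-- The kernel of `l` is a plane on which `g` is nonzero; complete `g` to a basis of the functionals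
there and recover the coefficient of `l` from `x₀`. -/
lemma exists_complementary_functional_mod (hE : Module.finrank ℝ E = 3) {l g : StrongDual ℝ E}
    {y₀ : E} (hly : l y₀ = 0) (hgy : g y₀ ≠ 0) {x₀ : E} (hlx : l x₀ ≠ 0) :
    ∃ h : StrongDual ℝ E, (∀ u : StrongDual ℝ E, ∃ a b c : ℝ, ∀ y,
        u y = a * g y + b * h y + c * l y) ∧
      ∀ a b c : ℝ, (∀ y, a * g y + b * h y + c * l y = 0) → b = 0 := by
  have hl : l.toLinearMap ≠ 0 := fun h => hlx (LinearMap.congr_fun h x₀)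
  have hker := Module.Dual.finrank_ker_add_one_of_ne_zero hl
  obtain ⟨h, -, hspan, hind⟩ := exists_complementary_functional (T := ⊥)
    (S := LinearMap.ker l.toLinearMap) bot_le (by rw [finrank_bot]; omega) (g := g)
    (fun y hy => by rw [(Submodule.mem_bot ℝ).1 hy, map_zero]) ⟨y₀, hly, hgy⟩
  refine ⟨h, fun u => ?_, fun a b c habc => hind a b fun y hy => ?_⟩
  · obtain ⟨a, b, hab⟩ := hspan u fun y hy => by rw [(Submodule.mem_bot ℝ).1 hy, map_zero]
    refine ⟨a, b, (u x₀ - a * g x₀ - b * h x₀) / l x₀, fun y => ?_⟩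
    have hy : y - (l y / l x₀) • x₀ ∈ LinearMap.ker l.toLinearMap := by simp [hlx]
    have := hab _ hy
    simp only [map_sub, map_smul, smul_eq_mul] at this
    field_simp at this ⊢
    linarith
  · have hy' : l y = 0 := hy
    simpa [hy'] using habc y

/-- A vertex of `P` that is neither the highest nor the lowest is a middle vertex of exactly two
facets. -/
theorem ncard_facets_middleVertices (hE : Module.finrank ℝ E = 3) (hP : IsPolytope P)
    (hd : dim P = 3) {l : StrongDual ℝ E} (hl : Set.InjOn l (P.extremePoints ℝ)) {v : E}
    (hv : v ∈ middleVertices l P) :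
    {F ∈ facesOfDim 2 P | v ∈ middleVertices l F}.ncard = 2 := by
  obtain ⟨-, g, hvg⟩ := isFace_iff.1 (hP.isFace_singleton hv.1)
  have hvg' : v ∈ g.toExposed P := hvg ▸ rfl
  have hg : ∀ w ∈ P, w ≠ v → g w < g v := fun w hw hne =>
    apply_lt_of_notMem_toExposed hvg' hw (by rw [← hvg]; exact hne)
  have htop : ∀ y, y ∈ vectorSpan ℝ P := fun y => by
    rw [Submodule.eq_top_of_finrank_eq (show Module.finrank ℝ (vectorSpan ℝ P) = _ from
      hd.trans hE.symm)]
    trivial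
  obtain ⟨h, hspan, hind⟩ : ∃ h : StrongDual ℝ E, (∀ u : StrongDual ℝ E, ∃ a b c : ℝ, ∀ y,
        u y = a * g y + b * h y + c * l y) ∧
      ∀ a b c : ℝ, (∀ y, a * g y + b * h y + c * l y = 0) → b = 0 := by
    obtain ⟨hvP, w, hw, w', hw', h1, h2⟩ := hv
    -- `y₀` is the positive combination of `w - v` and `w' - v` killed by `l`; `g` is negative on it
    -- because `v` is the strict maximum of `g`.
    refine exists_complementary_functional_mod hE (x₀ := w - v)
      (y₀ := (l v - l w') • (w - v) + (l w - l v) • (w' - v)) ?_ (ne_of_lt ?_) ?_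
    · simp only [map_add, map_smul, map_sub, smul_eq_mul]
      ring
    · simp only [map_add, map_smul, map_sub, smul_eq_mul]
      have e1 := hg w hw.1 (by rintro rfl; exact h2.false)
      have e2 := hg w' hw'.1 (by rintro rfl; exact h1.false)
      exact add_neg (mul_neg_of_pos_of_neg (by linarith) (by linarith))
        (mul_neg_of_pos_of_neg (by linarith) (by linarith))
    · rw [map_sub]
      linarith
  obtain ⟨M, t, hvM, ⟨w, hwP, hwM, hlw⟩, z, hzP, hzM, hlz⟩ := exists_tilt_across hP hl hv hg h
  obtain ⟨N, s, hvN, ⟨x, hxP, hxN, hlx⟩, y, hyP, hyN, hly⟩ := exists_tilt_across hP hl hv hg (-h)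
  -- The dimension must be two: `b ≠ 0` makes the face proper, and the three distinct vertices `z,
  -- v, w` exclude a point and a segment.
  have hmem : ∀ {u : StrongDual ℝ E} {w z : E} {a b c : ℝ},
      (∀ y, u y = a * g y + b * h y + c * l y) → b ≠ 0 → v ∈ u.toExposed P →
      w ∈ P.extremePoints ℝ → w ∈ u.toExposed P → l v < l w →
      z ∈ P.extremePoints ℝ → z ∈ u.toExposed P → l z < l v →
      u.toExposed P ∈ facesOfDim 2 P ∧ v ∈ middleVertices l (u.toExposed P) := by
    intro u w z a b c hu hb hvu hw hwu hlw hz hzu hlz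
    have hface := isFace_toExposed ⟨v, hvu⟩
    have hmid : v ∈ middleVertices l (u.toExposed P) := by
      simp only [middleVertices, hface.extremePoints_eq]
      exact ⟨⟨hvu, hv.1⟩, w, ⟨hwu, hw⟩, z, ⟨hzu, hz⟩, hlz, hlw⟩
    refine ⟨⟨hface, ?_⟩, hmid⟩
    have h3 := hface.dim_lt fun he => hb (hind a b c fun y => by
      rw [← hu y]
      exact (toExposed_eq_self_iff ⟨v, hvu⟩).1 he y (htop y))
    have h0 : dim (u.toExposed P) ≠ 0 := fun h0 => by
      have he := eq_singleton_of_dim_eq_zero h0 hvu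
      rw [he] at hwu
      rw [Set.mem_singleton_iff.1 hwu] at hlw
      exact hlw.false
    have h1 : dim (u.toExposed P) ≠ 1 := fun h1 => by
      have hpoly := hface.isPolytope hP
      have hc := ncard_extremePoints_of_dim_eq_one hpoly h1
      have hsub : ({z, v, w} : Set E) ⊆ (u.toExposed P).extremePoints ℝ := by
        rw [hface.extremePoints_eq]
        rintro x (rfl | rfl | rfl)
        exacts [⟨hzu, hz⟩, ⟨hvu, hv.1⟩, ⟨hwu, hw⟩]
      have hle := Set.ncard_le_ncard hsub hpoly.finite_extremePoints
      rw [Set.ncard_eq_three.2 ⟨z, v, w, by rintro rfl; exact hlz.false,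
        by rintro rfl; exact (hlz.trans hlw).false, by rintro rfl; exact hlw.false, rfl⟩] at hle
      omega
    omega
  have hMfun : ∀ y, (M • g + h + t • l) y = M * g y + 1 * h y + t * l y := fun y => by simp
  have hNfun : ∀ y, (N • g + -h + s • l) y = N * g y + (-1) * h y + s * l y := fun y => by simp
  have hFM := hmem hMfun one_ne_zero hvM hwP hwM hlw hzP hzM hlz
  have hFN := hmem hNfun (by norm_num) hvN hxP hxN hlx hyP hyN hly
  have hne : (M • g + h + t • l).toExposed P ≠ (N • g + -h + s • l).toExposed P := by
    intro he
    obtain ⟨c, hc, hcu⟩ := exists_pos_mul_of_toExposed_eq ⟨v, hvM⟩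
      (by rw [hFM.1.2, hd]) rfl he
    have : -1 - c = 0 := hind (N - c * M) _ (s - c * t) fun y => by
      have := hcu y (htop y)
      rw [hMfun, hNfun] at this
      linarith
    linarith
  refine Eq.trans (congrArg Set.ncard ?_) (Set.ncard_pair hne)
  ext F
  simp only [Set.mem_ofPred_eq, Set.mem_insert_iff, Set.mem_singleton_iff]
  constructor
  · rintro ⟨⟨hF, hFd⟩, hvF, w₁, hw₁, z₁, hz₁, hlz₁, hlw₁⟩
    obtain ⟨-, u, rfl⟩ := isFace_iff.1 hF
    obtain ⟨a, b, c, habc⟩ := hspan u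
    rcases lt_trichotomy b 0 with hb | rfl | hb
    · right
      exact tilt_across_unique (a := a) (c := c) (neg_pos.2 hb) hg hvN hxN hlx hyN hly
        hvF.1 hw₁.1 hlw₁ hz₁.1 hlz₁ fun y => by simp [habc y]
    · exfalso
      have e1 := apply_eq_of_mem_toExposed hw₁.1 hvF.1
      have e2 := apply_eq_of_mem_toExposed hz₁.1 hvF.1
      have g1 := hg w₁ hw₁.1.1 (by rintro rfl; exact hlw₁.false)
      have g2 := hg z₁ hz₁.1.1 (by rintro rfl; exact hlz₁.false)
      simp only [habc, zero_mul, add_zero] at e1 e2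
      have ha : a = 0 := by
        have h0 : a * ((l v - l z₁) * (g w₁ - g v) + (l w₁ - l v) * (g z₁ - g v)) = 0 := by
          linear_combination (l v - l z₁) * e1 + (l w₁ - l v) * e2
        exact (mul_eq_zero.1 h0).resolve_right (add_neg
          (mul_neg_of_pos_of_neg (by linarith) (by linarith))
          (mul_neg_of_pos_of_neg (by linarith) (by linarith))).ne
      have hc : c = 0 := by
        have h0 : c * (l w₁ - l v) = 0 := by
          rw [ha] at e1
          linarith
        exact (mul_eq_zero.1 h0).resolve_right (by linarith)
      have : u.toExposed P = P := eq_of_mem_toExposed_of_vectorSpan ⟨v, hvF.1⟩ fun y _ => by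
        simp [habc y, ha, hc]
      rw [this] at hFd
      omega
    · left
      exact tilt_across_unique hb hg hvM hwM hlw hzM hlz hvF.1 hw₁.1 hlw₁ hz₁.1 hlz₁ habc
  · rintro (rfl | rfl)
    exacts [hFM, hFN]

/-- **Euler's formula** for three-dimensional polytopes. -/
theorem euler_formula (hE : Module.finrank ℝ E = 3) (hP : IsPolytope P) (hd : dim P = 3) :
    numFaces 0 P + numFaces 2 P = numFaces 1 P + 2 := by
  obtain ⟨l, hl⟩ := exists_strongDual_injOn hP.finite_extremePoints
  have hdouble := sum_ncard_comm (hP.finite_facesOfDim 2) hP.finite_extremePoints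
    (fun F v => v ∈ middleVertices l F)
  have hleft : ∀ F ∈ (hP.finite_facesOfDim 2).toFinset,
      {v ∈ P.extremePoints ℝ | v ∈ middleVertices l F}.ncard + 2 = numFaces 0 F := by
    intro F hF
    have hF' : F ∈ facesOfDim 2 P := by simpa using hF
    have hpoly := hF'.1.isPolytope hP
    have hsub : F.extremePoints ℝ ⊆ P.extremePoints ℝ := by
      rw [hF'.1.extremePoints_eq]
      exact Set.inter_subset_right
    rw [numFaces_zero hpoly, ← ncard_between_add_two (hl.mono hsub)
      (two_le_ncard_extremePoints hpoly (by rw [hF'.2]; norm_num))]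
    congr 2
    ext v
    exact ⟨fun h => h.2, fun h => ⟨hsub h.1, h⟩⟩
  have hmid : (middleVertices l P).ncard + 2 = numFaces 0 P := by
    rw [numFaces_zero hP]
    exact ncard_between_add_two hl (two_le_ncard_extremePoints hP (by omega))
  have hsubmid : middleVertices l P ⊆ P.extremePoints ℝ := fun v h => h.1
  have hfinmid := hP.finite_extremePoints.subset hsubmid
  have hright : ∑ v ∈ hP.finite_extremePoints.toFinset,
      {F ∈ facesOfDim 2 P | v ∈ middleVertices l F}.ncard = 2 * (middleVertices l P).ncard := by
    rw [← Finset.sum_subset (s₁ := hfinmid.toFinset) (by simpa using hsubmid)]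
    · rw [Finset.sum_const_nat (m := 2), ← Set.ncard_eq_toFinset_card _ hfinmid, mul_comm]
      intro v hv
      exact ncard_facets_middleVertices hE hP hd hl (by simpa using hv)
    -- A middle vertex of a facet is a middle vertex of `P`, so the top and bottom of `P` contribute
    -- nothing.
    · intro v _ hv
      rw [Set.ncard_eq_zero ((hP.finite_facesOfDim 2).subset fun F h => h.1),
        Set.eq_empty_iff_forall_notMem]
      rintro F ⟨hF, hvF, w, hw, w', hw', hlt⟩
      rw [hF.1.extremePoints_eq] at hvF hw hw'
      exact hv (by simpa using ⟨hvF.2, w, hw.2, w', hw'.2, hlt⟩)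
  have hsum := two_mul_numFaces_one hP hd
  rw [← Finset.sum_congr rfl hleft, Finset.sum_add_distrib, hdouble, hright, Finset.sum_const,
    ← Set.ncard_eq_toFinset_card _ (hP.finite_facesOfDim 2), smul_eq_mul] at hsum
  have h2 : numFaces 2 P = (facesOfDim 2 P).ncard := rfl
  omega

end Euler

/-! ### Faces of Minkowski sums -/

section MinkowskiSum

variable {A B P F : Set E} {ι : Type*}

lemma IsPolytope.add (hA : IsPolytope A) (hB : IsPolytope B) : IsPolytope (A + B) := by
  obtain ⟨s, hs, rfl⟩ := hA
  obtain ⟨t, ht, rfl⟩ := hB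
  exact ⟨s + t, hs.add ht, (convexHull_add s t).symm⟩

lemma isPolytope_singleton (p : E) : IsPolytope ({p} : Set E) :=
  ⟨{p}, Set.finite_singleton p, (convexHull_singleton p).symm⟩

lemma IsPolytope.sum {P : ι → Set E} (hP : ∀ i, IsPolytope (P i)) (s : Finset ι) :
    IsPolytope (∑ i ∈ s, P i) := by
  classical
  induction s using Finset.induction with
  | empty => exact isPolytope_singleton 0
  | insert i s hi ih =>
    rw [Finset.sum_insert hi]
    exact (hP i).add ih

/-- The two terms of a sum vary independently, so `u` is maximized on each separately. -/
lemma toExposed_add (u : StrongDual ℝ E) (A B : Set E) :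
    u.toExposed (A + B) = u.toExposed A + u.toExposed B := by
  ext x
  constructor
  · rintro ⟨⟨a, ha, b, hb, rfl⟩, hmax⟩
    refine ⟨a, ⟨ha, fun y hy => ?_⟩, b, ⟨hb, fun y hy => ?_⟩, rfl⟩
    · simpa using hmax _ (Set.add_mem_add hy hb)
    · simpa using hmax _ (Set.add_mem_add ha hy)
  · rintro ⟨a, ha, b, hb, rfl⟩
    refine ⟨Set.add_mem_add ha.1 hb.1, ?_⟩
    rintro _ ⟨y, hy, z, hz, rfl⟩
    simpa using add_le_add (ha.2 y hy) (hb.2 z hz)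

lemma toExposed_sum (u : StrongDual ℝ E) (P : ι → Set E) (s : Finset ι) :
    u.toExposed (∑ i ∈ s, P i) = ∑ i ∈ s, u.toExposed (P i) := by
  classical
  induction s using Finset.induction with
  | empty =>
    refine Set.Subset.antisymm (fun x hx => hx.1) fun x hx => ⟨hx, fun y hy => ?_⟩
    rw [Finset.sum_empty] at hx hy
    rw [Set.mem_zero.1 hx, Set.mem_zero.1 hy]
  | insert i s hi ih => rw [Finset.sum_insert hi, Finset.sum_insert hi, toExposed_add, ih]

lemma vectorSpan_le_vectorSpan_add_right (hB : B.Nonempty) :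
    vectorSpan ℝ A ≤ vectorSpan ℝ (A + B) := by
  obtain ⟨b, hb⟩ := hB
  rcases A.eq_empty_or_nonempty with rfl | ⟨a, ha⟩
  · simp
  · refine (vectorSpan_le_iff ha).2 fun x hx => ?_
    have := sub_mem_vectorSpan (Set.add_mem_add hx hb) (Set.add_mem_add ha hb)
    rwa [add_sub_add_right_eq_sub] at this

lemma vectorSpan_add_le : vectorSpan ℝ (A + B) ≤ vectorSpan ℝ A ⊔ vectorSpan ℝ B := by
  rcases (A + B).eq_empty_or_nonempty with h | ⟨_, a, ha, b, hb, rfl⟩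
  · simp [h]
  · refine (vectorSpan_le_iff (Set.add_mem_add ha hb)).2 ?_
    rintro _ ⟨x, hx, y, hy, rfl⟩
    have : x + y - (a + b) = (x - a) + (y - b) := by abel
    change x + y - (a + b) ∈ _
    rw [this]
    exact Submodule.add_mem_sup (sub_mem_vectorSpan hx ha) (sub_mem_vectorSpan hy hb)

omit [NormedSpace ℝ E] in
lemma nonempty_sum {P : ι → Set E} (hP : ∀ i, (P i).Nonempty) (s : Finset ι) :
    (∑ i ∈ s, P i).Nonempty := by
  choose p hp using hP
  exact ⟨∑ i ∈ s, p i, Set.finsetSum_mem_finsetSum s P p fun i _ => hp i⟩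

lemma vectorSpan_le_vectorSpan_sum {P : ι → Set E} (hP : ∀ i, (P i).Nonempty) {s : Finset ι}
    {i : ι} (hi : i ∈ s) : vectorSpan ℝ (P i) ≤ vectorSpan ℝ (∑ i ∈ s, P i) := by
  classical
  rw [← Finset.add_sum_erase s P hi]
  exact vectorSpan_le_vectorSpan_add_right (nonempty_sum hP _)

omit [NormedSpace ℝ E] in
lemma exists_sum_eq_singleton {P : ι → Set E} {s : Finset ι}
    (hP : ∀ i ∈ s, ∃ p, P i = {p}) : ∃ p, ∑ i ∈ s, P i = {p} := by
  classical
  induction s using Finset.induction with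
  | empty => exact ⟨0, rfl⟩
  | insert i s hi ih =>
    obtain ⟨p, hp⟩ := hP i (Finset.mem_insert_self i s)
    obtain ⟨q, hq⟩ := ih fun j hj => hP j (Finset.mem_insert_of_mem hj)
    exact ⟨p + q, by rw [Finset.sum_insert hi, hp, hq, Set.singleton_add_singleton]⟩

lemma extremePoints_add_singleton (A : Set E) (p : E) :
    (A + {p}).extremePoints ℝ = (fun x => x + p) '' A.extremePoints ℝ := by
  rw [Set.add_singleton]
  ext x
  simp only [mem_extremePoints_iff_left, Set.mem_image]
  constructor
  · rintro ⟨⟨a, ha, rfl⟩, h⟩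
    refine ⟨a, ⟨ha, fun y hy z hz hyz => ?_⟩, rfl⟩
    refine add_right_cancel (h _ ⟨y, hy, rfl⟩ _ ⟨z, hz, rfl⟩ ?_)
    rw [add_comm a, add_comm y, add_comm z, mem_openSegment_translate]
    exact hyz
  · rintro ⟨a, ⟨ha, h⟩, rfl⟩
    refine ⟨⟨a, ha, rfl⟩, ?_⟩
    rintro _ ⟨y, hy, rfl⟩ _ ⟨z, hz, rfl⟩ hyz
    rw [add_comm a, add_comm y, add_comm z, mem_openSegment_translate] at hyz
    rw [h y hy z hz hyz]

lemma IsPolytope.extremePoints_add_subset (hA : IsPolytope A) (hB : IsPolytope B) :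
    (A + B).extremePoints ℝ ⊆ A.extremePoints ℝ + B.extremePoints ℝ := by
  intro v hv
  obtain ⟨-, u, hu⟩ := isFace_iff.1 ((hA.add hB).isFace_singleton hv)
  have hv' : v ∈ u.toExposed A + u.toExposed B := by
    rw [← toExposed_add, ← hu]
    rfl
  obtain ⟨a, ha, b, hb, -⟩ := hv'
  have hFA := isFace_toExposed ⟨a, ha⟩
  have hFB := isFace_toExposed ⟨b, hb⟩
  obtain ⟨x, hx⟩ := (hFA.isPolytope hA).nonempty_extremePoints hFA.1
  obtain ⟨y, hy⟩ := (hFB.isPolytope hB).nonempty_extremePoints hFB.1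
  have hxy : x + y ∈ u.toExposed (A + B) := by
    rw [toExposed_add]
    exact Set.add_mem_add hx.1 hy.1
  rw [← hu, Set.mem_singleton_iff] at hxy
  rw [hFA.extremePoints_eq] at hx
  rw [hFB.extremePoints_eq] at hy
  exact ⟨x, hx.2, y, hy.2, hxy⟩

variable [FiniteDimensional ℝ E]

lemma numFaces_zero_add_singleton (hA : IsPolytope A) (p : E) :
    numFaces 0 (A + {p}) = numFaces 0 A := by
  rw [numFaces_zero (hA.add (isPolytope_singleton p)), numFaces_zero hA,
    extremePoints_add_singleton, Set.ncard_image_of_injective _ (add_left_injective p)]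

/-- A parallelogram has four vertices. -/
theorem numFaces_zero_parallelogram (hA : IsPolytope A) (hB : IsPolytope B) (hdA : dim A = 1)
    (hdB : dim B = 1) (hd : 2 ≤ dim (A + B)) : numFaces 0 (A + B) = 4 := by
  obtain ⟨⟨p, hpA⟩, -, hp⟩ := finrank_eq_one_iff'.1 hdA
  obtain ⟨⟨q, hqB⟩, -, hq⟩ := finrank_eq_one_iff'.1 hdB
  replace hp : ∀ y ∈ vectorSpan ℝ A, ∃ c : ℝ, c • p = y := fun y hy => by
    obtain ⟨c, hc⟩ := hp ⟨y, hy⟩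
    exact ⟨c, congrArg Subtype.val hc⟩
  replace hq : ∀ y ∈ vectorSpan ℝ B, ∃ c : ℝ, c • q = y := fun y hy => by
    obtain ⟨c, hc⟩ := hq ⟨y, hy⟩
    exact ⟨c, congrArg Subtype.val hc⟩
  have hqA : q ∉ vectorSpan ℝ A := fun h => by
    have hle : vectorSpan ℝ (A + B) ≤ vectorSpan ℝ A := vectorSpan_add_le.trans
      (sup_le le_rfl fun y hy => by
        obtain ⟨c, rfl⟩ := hq y hy
        exact Submodule.smul_mem _ _ h)
    have := Submodule.finrank_mono hle
    simp only [dim] at hd hdA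
    omega
  have hpB : p ∉ vectorSpan ℝ B := fun h => by
    have hle : vectorSpan ℝ (A + B) ≤ vectorSpan ℝ B := vectorSpan_add_le.trans
      (sup_le (fun y hy => by
        obtain ⟨c, rfl⟩ := hp y hy
        exact Submodule.smul_mem _ _ h) le_rfl)
    have := Submodule.finrank_mono hle
    simp only [dim] at hd hdB
    omega
  obtain ⟨φ, hφA, hφq⟩ := exists_strongDual_of_notMem hqA
  obtain ⟨ψ, hψB, hψp⟩ := exists_strongDual_of_notMem hpB
  have hvert : (A + B).extremePoints ℝ = A.extremePoints ℝ + B.extremePoints ℝ := by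
    refine (hA.extremePoints_add_subset hB).antisymm ?_
    rintro _ ⟨x, hx, y, hy, rfl⟩
    obtain ⟨-, f, hf⟩ := isFace_iff.1 (hA.isFace_singleton hx)
    obtain ⟨-, g, hg⟩ := isFace_iff.1 (hB.isFace_singleton hy)
    -- `φ` vanishes along `A` and `ψ` along `B`, so `u` agrees with `f` along `A` and with `g` along
    -- `B`: any vertex of `A` pairs with any vertex of `B`.
    set u : StrongDual ℝ E := (f p / ψ p) • ψ + (g q / φ q) • φ with hu
    have hue : u.toExposed (A + B) = {x + y} := by
      have hA' : u.toExposed A = f.toExposed A := toExposed_congr one_pos fun z hz => by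
        obtain ⟨c, rfl⟩ := hp z hz
        simp [hu, hφA p hpA, hψp]
      have hB' : u.toExposed B = g.toExposed B := toExposed_congr one_pos fun z hz => by
        obtain ⟨c, rfl⟩ := hq z hz
        simp [hu, hψB q hqB, hφq]
      rw [toExposed_add, hA', hB', ← hf, ← hg, Set.singleton_add_singleton]
    refine (isFace_singleton_iff (hA.add hB)).1 ?_
    rw [← hue]
    exact isFace_toExposed (by rw [hue]; exact Set.singleton_nonempty _)
  have hinj : Set.InjOn (fun z : E × E => z.1 + z.2)
      (A.extremePoints ℝ ×ˢ B.extremePoints ℝ) := by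
    rintro ⟨x, y⟩ ⟨hx, hy⟩ ⟨x', y'⟩ ⟨hx', hy'⟩ h
    have h' : x + y = x' + y' := h
    have hxx : x - x' ∈ vectorSpan ℝ A := sub_mem_vectorSpan hx.1 hx'.1
    have hyy : y' - y ∈ vectorSpan ℝ B := sub_mem_vectorSpan hy'.1 hy.1
    have he : x - x' = y' - y := by
      rw [sub_eq_sub_iff_add_eq_add, h', add_comm]
    obtain ⟨c, hc⟩ := hp _ hxx
    have h0 : ψ (x - x') = 0 := by
      rw [he]
      exact hψB _ hyy
    rw [← hc, map_smul, smul_eq_mul] at h0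
    rw [(mul_eq_zero.1 h0).resolve_right hψp, zero_smul] at hc
    have hxe : x = x' := sub_eq_zero.1 hc.symm
    have hye : y' = y := sub_eq_zero.1 (he ▸ hc.symm)
    rw [hxe, hye]
  rw [numFaces_zero (hA.add hB), hvert, ← Set.add_image_prod, hinj.ncard_image,
    Set.ncard_prod, ncard_extremePoints_of_dim_eq_one hA hdA,
    ncard_extremePoints_of_dim_eq_one hB hdB]

/-- The vertices of an exact sum of dimension two: either one summand is a translate of the sum,
or the sum is a parallelogram. -/
theorem four_sub_numFaces_zero_sum [Fintype ι] {G : ι → Set E} (hG : ∀ i, IsPolytope (G i))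
    (hne : ∀ i, (G i).Nonempty) (hd : dim (∑ i, G i) = 2) (hsum : ∑ i, dim (G i) = 2) :
    (4 - numFaces 0 (∑ i, G i) : ℤ) =
      ∑ i, if dim (G i) = 2 then (4 - numFaces 0 (G i) : ℤ) else 0 := by
  classical
  have hpt : ∀ {i}, dim (G i) = 0 → ∃ p, G i = {p} := fun {i} h => by
    obtain ⟨p, hp⟩ := hne i
    exact ⟨p, eq_singleton_of_dim_eq_zero h hp⟩
  by_cases h2 : ∃ i, dim (G i) = 2
  · obtain ⟨i, hi⟩ := h2
    have hrest : ∀ j ∈ Finset.univ.erase i, dim (G j) = 0 := by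
      have := Finset.add_sum_erase Finset.univ (fun j => dim (G j)) (Finset.mem_univ i)
      rw [← Finset.sum_eq_zero_iff]
      omega
    obtain ⟨p, hp⟩ := exists_sum_eq_singleton fun j hj => hpt (hrest j hj)
    rw [← Finset.add_sum_erase _ _ (Finset.mem_univ i), hp,
      numFaces_zero_add_singleton (hG i), Finset.sum_eq_single i, if_pos hi]
    · intro j _ hj
      rw [if_neg]
      rw [hrest j (by simpa using hj)]
      norm_num
    · simp
  · push Not at h2
    have hle : ∀ i, dim (G i) ≤ 2 := fun i => by
      rw [← hsum]
      exact Finset.single_le_sum (f := fun i => dim (G i)) (fun _ _ => Nat.zero_le _)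
        (Finset.mem_univ i)
    obtain ⟨i, -, hi⟩ : ∃ i ∈ Finset.univ, dim (G i) ≠ 0 := by
      apply Finset.exists_ne_zero_of_sum_ne_zero
      omega
    have hi1 : dim (G i) = 1 := by
      have := h2 i
      have := hle i
      omega
    have hsi := Finset.add_sum_erase Finset.univ (fun j => dim (G j)) (Finset.mem_univ i)
    obtain ⟨j, hj, hj0⟩ : ∃ j ∈ Finset.univ.erase i, dim (G j) ≠ 0 := by
      apply Finset.exists_ne_zero_of_sum_ne_zero
      omega
    have hj1 : dim (G j) = 1 := by
      have := h2 j
      have := hle j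
      omega
    have hsj := Finset.add_sum_erase _ (fun j => dim (G j)) hj
    have hrest : ∀ k ∈ (Finset.univ.erase i).erase j, dim (G k) = 0 := by
      rw [← Finset.sum_eq_zero_iff]
      omega
    obtain ⟨p, hp⟩ := exists_sum_eq_singleton fun k hk => hpt (hrest k hk)
    have hsplit : ∑ k, G k = G i + G j + {p} := by
      rw [← Finset.add_sum_erase _ _ (Finset.mem_univ i), ← Finset.add_sum_erase _ _ hj, hp,
        add_assoc]
    rw [Finset.sum_eq_zero fun k _ => if_neg (h2 k), hsplit,
      numFaces_zero_add_singleton ((hG i).add (hG j)),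
      numFaces_zero_parallelogram (hG i) (hG j) hi1 hj1]
    · norm_num
    · rw [← hd, hsplit]
      refine Submodule.finrank_mono (vectorSpan_add_le.trans ?_)
      simp

lemma vectorSpan_eq_top_of_dim_eq (h : dim P = Module.finrank ℝ E) : vectorSpan ℝ P = ⊤ :=
  Submodule.eq_top_of_finrank_eq h

/-- The weight `4 - f₀` vanishes on parallelograms; its total follows from counting edge–facet
flags. -/
lemma sum_four_sub_numFaces_zero (hP : IsPolytope P) (hd : dim P = 3) :
    ∑ F ∈ (hP.finite_facesOfDim 2).toFinset, (4 - numFaces 0 F : ℤ) =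
      2 * (2 * numFaces 2 P - numFaces 1 P) := by
  have h := two_mul_numFaces_one hP hd
  rw [Finset.sum_sub_distrib, Finset.sum_const, ← Set.ncard_eq_toFinset_card _
    (hP.finite_facesOfDim 2), ← Nat.cast_sum, ← h, nsmul_eq_mul]
  change ((numFaces 2 P : ℕ) : ℤ) * 4 - _ = _
  push_cast
  ring

/-- For polytopes in general position `2 f₂ - f₁` is additive under Minkowski sums. -/
theorem two_mul_numFaces_two_sub_numFaces_one_sum (hE : Module.finrank ℝ E = 3) {n : ℕ}
    {P : Fin n → Set E} (hP : ∀ i, IsPolytope (P i)) (hdim : ∀ i, dim (P i) = 3)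
    (hS : dim (∑ i, P i) = 3) (hgen : RelativelyInGeneralPosition P) :
    2 * (numFaces 2 (∑ i, P i) : ℤ) - numFaces 1 (∑ i, P i) =
      ∑ i, (2 * (numFaces 2 (P i) : ℤ) - numFaces 1 (P i)) := by
  have hne : ∀ i, (P i).Nonempty := fun i => nonempty_of_dim_pos (by rw [hdim i]; norm_num)
  have hSP : IsPolytope (∑ i, P i) := IsPolytope.sum hP _
  have htopS := vectorSpan_eq_top_of_dim_eq (hS.trans hE.symm)
  have htop := fun i => vectorSpan_eq_top_of_dim_eq ((hdim i).trans hE.symm)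
  have hface : ∀ i (u : StrongDual ℝ E), IsFace (P i) (u.toExposed (P i)) := fun i u =>
    isFace_toExposed ((hP i).nonempty_toExposed (hne i) u)
  have hex : ∀ F ∈ facesOfDim 2 (∑ i, P i), ∃ u : StrongDual ℝ E,
      F = u.toExposed (∑ i, P i) := fun F hF => (isFace_iff.1 hF.1).2
  choose! u hu using hex
  have hlocal : ∀ F ∈ (hSP.finite_facesOfDim 2).toFinset, (4 - numFaces 0 F : ℤ) =
      ∑ i, if dim ((u F).toExposed (P i)) = 2 then
        (4 - numFaces 0 ((u F).toExposed (P i)) : ℤ) else 0 := by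
    intro F hF
    have hF' : F ∈ facesOfDim 2 (∑ i, P i) := by simpa using hF
    have hdec : F = ∑ i, (u F).toExposed (P i) := by rw [← toExposed_sum, ← hu F hF']
    have hex := hgen F ⟨hF'.1, by rw [hF'.2, hS]⟩ _ ⟨fun i => hface i (u F), hdec⟩
    have := four_sub_numFaces_zero_sum (fun i => (hface i (u F)).isPolytope (hP i))
      (fun i => (hface i (u F)).1) (by rw [← hdec, hF'.2]) (by rw [← hex, hF'.2])
    rwa [← hdec] at this
  have hbij : ∀ i, ∑ F ∈ (hSP.finite_facesOfDim 2).toFinset,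
      (if dim ((u F).toExposed (P i)) = 2 then
        (4 - numFaces 0 ((u F).toExposed (P i)) : ℤ) else 0) =
      ∑ H ∈ ((hP i).finite_facesOfDim 2).toFinset, (4 - numFaces 0 H : ℤ) := by
    intro i
    rw [← Finset.sum_filter]
    refine Finset.sum_nbij (fun F => (u F).toExposed (P i)) ?_ ?_ ?_ fun _ _ => rfl
    · intro F hF
      rw [Finset.mem_filter] at hF
      simpa using show _ ∈ facesOfDim 2 (P i) from ⟨hface i _, hF.2⟩
    · intro F hF F' hF' he
      simp only [Finset.coe_filter, Set.Finite.mem_toFinset, Set.mem_ofPred_eq] at hF hF'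
      -- Injectivity: a common facet of `P i` forces the two normals to be positively proportional,
      -- hence to expose the same facet of the sum.
      obtain ⟨c, hc, hcu⟩ := exists_pos_mul_of_toExposed_eq (hface i (u F)).1
        (by rw [hF.2, hdim i]) rfl he
      rw [hu F hF.1, hu F' hF'.1]
      refine (toExposed_congr hc fun y _ => hcu y ?_).symm
      rw [htop i]
      trivial
    · intro H hH
      have hH' : H ∈ facesOfDim 2 (P i) := by simpa using hH
      obtain ⟨hHne, w, rfl⟩ := isFace_iff.1 hH'.1
      -- Surjectivity: the normal `w` of a facet of `P i` exposes a proper face of the sum of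
      -- dimension at least two, so a facet. Its chosen normal is a positive multiple of `w`.
      have hFface : IsFace (∑ i, P i) (w.toExposed (∑ i, P i)) :=
        isFace_toExposed (hSP.nonempty_toExposed (nonempty_sum hne _) w)
      have hlt : dim (w.toExposed (∑ i, P i)) < dim (∑ i, P i) := hFface.dim_lt fun he => by
        have h0 := (toExposed_eq_self_iff hFface.1).1 he
        have := hH'.2
        rw [eq_of_mem_toExposed_of_vectorSpan hHne fun y _ => h0 y (by rw [htopS]; trivial),
          hdim i] at this
        omega
      have hge : dim (w.toExposed (P i)) ≤ dim (w.toExposed (∑ i, P i)) := by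
        rw [toExposed_sum]
        exact Submodule.finrank_mono (vectorSpan_le_vectorSpan_sum
          (P := fun i => w.toExposed (P i)) (fun i => (hface i w).1) (Finset.mem_univ i))
      have hF : w.toExposed (∑ i, P i) ∈ facesOfDim 2 (∑ i, P i) :=
        ⟨hFface, by have := hH'.2; omega⟩
      obtain ⟨c, hc, hcu⟩ := exists_pos_mul_of_toExposed_eq hFface.1 (by rw [hF.2, hS]) rfl
        (hu _ hF)
      have he : (u (w.toExposed (∑ i, P i))).toExposed (P i) = w.toExposed (P i) :=
        toExposed_congr hc fun y _ => hcu y (by rw [htopS]; trivial)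
      refine ⟨w.toExposed (∑ i, P i), ?_, he⟩
      simp only [Finset.coe_filter, Set.Finite.mem_toFinset, Set.mem_ofPred_eq]
      exact ⟨hF, by rw [he, hH'.2]⟩
  have hmain := sum_four_sub_numFaces_zero hSP hS
  rw [Finset.sum_congr rfl hlocal, Finset.sum_comm, Finset.sum_congr rfl fun i _ => hbij i,
    Finset.sum_congr rfl fun i _ => sum_four_sub_numFaces_zero (hP i) (hdim i),
    ← Finset.mul_sum] at hmain
  linarith

end MinkowskiSum

end PolytopeSum

/-! ### The three identities -/

open PolytopeSum in
theorem theorem3 (n : ℕ) (hn : 1 ≤ n) (P : Fin n → Set (EuclideanSpace ℝ (Fin 3)))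
    (hP : ∀ i, IsPolytope (P i)) (hdim : ∀ i, dim (P i) = 3)
    (hgen : RelativelyInGeneralPosition P) :
    (2 * (numFaces 2 (∑ i, P i) : ℤ) - numFaces 1 (∑ i, P i)
        = ∑ i, (2 * (numFaces 2 (P i) : ℤ) - numFaces 1 (P i))) ∧
    ((numFaces 2 (∑ i, P i) : ℤ) - numFaces 0 (∑ i, P i) + 2
        = ∑ i, ((numFaces 2 (P i) : ℤ) - numFaces 0 (P i) + 2)) ∧
    ((numFaces 1 (∑ i, P i) : ℤ) - 2 * numFaces 0 (∑ i, P i) + 4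
        = ∑ i, ((numFaces 1 (P i) : ℤ) - 2 * numFaces 0 (P i) + 4)) := by
  have hE : Module.finrank ℝ (EuclideanSpace ℝ (Fin 3)) = 3 := finrank_euclideanSpace_fin
  have hne : ∀ i, (P i).Nonempty := fun i => nonempty_of_dim_pos (by rw [hdim i]; norm_num)
  have hS : dim (∑ i, P i) = 3 := by
    refine le_antisymm ((Submodule.finrank_le _).trans_eq hE) ?_
    exact (hdim ⟨0, hn⟩).ge.trans
      (Submodule.finrank_mono (vectorSpan_le_vectorSpan_sum hne (Finset.mem_univ _)))
  have hmain := two_mul_numFaces_two_sub_numFaces_one_sum hE hP hdim hS hgen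
  have eulerS := euler_formula hE (IsPolytope.sum hP Finset.univ) hS
  have euler := fun i => euler_formula hE (hP i) (hdim i)
  refine ⟨hmain, ?_, ?_⟩
  -- Euler's formula, for the sum and for each summand, reduces this identity and the next to
  -- `hmain`.
  · calc _ = 2 * (numFaces 2 (∑ i, P i) : ℤ) - numFaces 1 (∑ i, P i) := by omega
      _ = _ := hmain
      _ = _ := Finset.sum_congr rfl fun i _ => by have := euler i; omega
  · calc _ = 2 * (numFaces 2 (∑ i, P i) : ℤ) - numFaces 1 (∑ i, P i) := by omega
      _ = _ := hmain
      _ = _ := Finset.sum_congr rfl fun i _ => by have := euler i; omega
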